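/- Let $V=\mathbb{C}^n$ with basis $v_1,\dots,v_n$ and $W=\mathbb{C}^2$ with basis $w_1,w_2$. For $m\ge 0$ let $G_m=\mathfrak{S}_m\ltimes(\mathbb{C}^*)^m$. The group $G_n$ acts on $V$ by $\sigma v_i=v_{\sigma(i)}$ for $\sigma\in\mathfrak{S}_n$ and $t v_i=t_i^{-1}v_i$ for $t\in(\mathbb{C}^*)^n$ (so $v_i$ has multidegree $-\mathbf{e}_i$), and $G_2$ acts on $W$ in the same way. Let $A=\bigwedge(V\otimes W)^*$ with the induced action of $G_n\times G_2$. For a multidegree $\mathbf{d}=\mathbf{a}\times\mathbf{b}\in\mathbb{Z}^n\times\mathbb{Z}^2$ let $A_{\mathbf{d}}$ be the subspace on which $(\mathbb{C}^*)^n\times(\mathbb{C}^*)^2$ acts by the character $\chi_{\mathbf{a}}\chi_{\mathbf{b}}$, where $\chi_{\mathbf{a}}(t)=\prod_i t_i^{a_i}$, and let $A_{\langle\mathbf{d}\rangle}$ be the $G_n\times G_2$-subrepresentation of $A$ which is the sum of the $A_{\mathbf{d}'}$ over all $\mathbf{d}'$ in the $\mathfrak{S}_n\times\mathfrak{S}_2$-orbit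 of $\mathbf{d}$. Let $[\lambda]$ denote the Specht module (the irreducible complex representation of $\mathfrak{S}_{|\lambda|}$) of a partition $\lambda$, so that $[m]$ is trivial and $[1^m]$ is the sign representation. For representations $\rho,\sigma$ of $\mathfrak{S}_p,\mathfrak{S}_q$, let $\mathrm{Ind}(\rho,\sigma)$ be the representation of $\mathfrak{S}_{p+q}$ induced from the representation $\rho\boxtimes\sigma$ of $\mathfrak{S}_p\times\mathfrak{S}_q$. For representations $\rho_i$ of $\mathfrak{S}_{p_i}$ with $p_1+\dots+p_\ell=m$ and $\mathbf{a}=(d_1^{p_1},\dots,d_\ell^{p_\ell})$, put \[ (\rho_1,\dots,\rho_\ell)_{\langle\mathbf{a}\rangle}=\mathrm{Ind}_{(\mathfrak{S}_{p_1}\times\dots\times\mathfrak{S}_{p_\ell})\ltimes(\mathbb{C}^*)^m}^{G_m}\big((\rho_1\boxtimes\dots\boxtimes\rho_\ell)\otimes\chi_{\mathbf{a}}\big), \] a representation of $G_m$. Let $n,a,b,c\ge 0$ be integers with $a+b\le n$ and $c\le\lfloor b/2\rfloor$, and let $\mathbf{d}=(2^a,1^b,0^{n-a-b})\times(a+b-c,\,a+c)$.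 Then there is an isomorphism of $G_n\times G_2$-representations \[ A_{\langle\mathbf{d}\rangle}\cong \begin{cases} ([a],\mathrm{Ind}([1^{b-c}],[1^c]),[n-a-b])_{\langle 2^a,1^b,0^{n-a-b}\rangle}\boxtimes([1],[1])_{\langle a+b-c,\,a+c\rangle} & \text{if } c\ne \tfrac b2,\\[4pt] \displaystyle\bigoplus_{j=0}^{c}([a],[2^{c-j},1^{2j}],[n-a-b])_{\langle 2^a,1^b,0^{n-a-b}\rangle}\boxtimes\big([1^2]^{\otimes(a+c-j)}\big)_{\langle(a+c)^2\rangle} & \text{if } c=\tfrac b2. \end{cases} \] -/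

import Mathlib

open scoped TensorProduct DirectSum

noncomputable section

namespace TorusSym

/-! ### External tensor products, tensor powers, Young subgroups, induction -/

/-- The external tensor product `ρ ⊠ σ` of representations of two groups. -/
def boxtimes {G H M N : Type*} [Group G] [Group H] [AddCommGroup M] [Module ℂ M]
    [AddCommGroup N] [Module ℂ N] (ρ : Representation ℂ G M) (σ : Representation ℂ H N) :
    Representation ℂ (G × H) (M ⊗[ℂ] N) :=
  Representation.tprod (ρ.comp (MonoidHom.fst G H)) (σ.comp (MonoidHom.snd G H))

/-- The `k`-th tensor power `ρ^{⊗ k}` (for `k = 0` the trivial representation). -/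
def tensorPower {G M : Type*} [Group G] [AddCommGroup M] [Module ℂ M]
    (ρ : Representation ℂ G M) (k : ℕ) : Representation ℂ G (⨂[ℂ] _ : Fin k, M) :=
  (PiTensorProduct.mapMonoidHom (R := ℂ) (s := fun _ : Fin k => M)).comp
    (MonoidHom.pi fun _ => ρ)

/-- The embedding `𝔖_p × 𝔖_q → 𝔖_m` for `p + q = m`: the first factor permutes the first `p`
indices, the second factor the last `q` indices. -/
def young₂ {p q m : ℕ} (h : p + q = m) :
    Equiv.Perm (Fin p) × Equiv.Perm (Fin q) →* Equiv.Perm (Fin m) :=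
  (((finSumFinEquiv (m := p) (n := q)).trans (finCongr h)).permCongrHom.toMonoidHom).comp
    (Equiv.Perm.sumCongrHom (Fin p) (Fin q))

/-- The embedding `𝔖_p × 𝔖_q × 𝔖_r → 𝔖_n` for `p + q + r = n`, permuting three consecutive
blocks of indices. -/
def young₃ {p q r n : ℕ} (h : p + (q + r) = n) :
    Equiv.Perm (Fin p) × Equiv.Perm (Fin q) × Equiv.Perm (Fin r) →* Equiv.Perm (Fin n) :=
  (young₂ h).comp ((MonoidHom.id _).prodMap (young₂ rfl))

/-- The space of the representation induced along `φ : G → H` from a representation of `G`. -/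
def IndSpace {G H M : Type*} [Group G] [Group H] [AddCommGroup M] [Module ℂ M] (φ : G →* H)
    (ρ : Representation ℂ G M) : Type _ :=
  Representation.IndV φ ρ

instance {G H M : Type*} [Group G] [Group H] [AddCommGroup M] [Module ℂ M] (φ : G →* H)
    (ρ : Representation ℂ G M) : AddCommGroup (IndSpace φ ρ) :=
  inferInstanceAs (AddCommGroup (Representation.IndV φ ρ))

instance {G H M : Type*} [Group G] [Group H] [AddCommGroup M] [Module ℂ M] (φ : G →* H)
    (ρ : Representation ℂ G M) : Module ℂ (IndSpace φ ρ) :=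
  inferInstanceAs (Module ℂ (Representation.IndV φ ρ))

/-- The representation of `H` induced along `φ : G → H` from a representation of `G`. -/
def ind {G H M : Type*} [Group G] [Group H] [AddCommGroup M] [Module ℂ M] (φ : G →* H)
    (ρ : Representation ℂ G M) : Representation ℂ H (IndSpace φ ρ) :=
  Representation.ind φ ρ

/-- `Ind(ρ, σ)`: the representation of `𝔖_m` induced from the representation `ρ ⊠ σ` of the
Young subgroup `𝔖_p × 𝔖_q`, where `p + q = m`. -/
def indPair {p q m : ℕ} (h : p + q = m) {M N : Type*} [AddCommGroup M] [Module ℂ M]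
    [AddCommGroup N] [Module ℂ N] (ρ : Representation ℂ (Equiv.Perm (Fin p)) M)
    (σ : Representation ℂ (Equiv.Perm (Fin q)) N) :
    Representation ℂ (Equiv.Perm (Fin m))
      (IndSpace (young₂ h) (boxtimes ρ σ)) :=
  ind (young₂ h) (boxtimes ρ σ)

/-! ### Specht modules -/

/-- The `k`-th cell (row, column), read row by row from the top, of the diagram with row
lengths given by a list. -/
def cell : List ℕ → ℕ → ℕ × ℕ
  | [], k => (0, k)
  | l :: L, k => if k < l then (0, k) else ((cell L (k - l)).1 + 1, (cell L (k - l)).2)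

/-- The cell of the Young diagram of `lam` containing the index `i`, in the tableau obtained by
numbering the cells consecutively, row by row. -/
def tableauCell {n : ℕ} (lam : n.Partition) (i : Fin n) : ℕ × ℕ :=
  cell (lam.parts.sort (· ≥ ·)) i

open Classical in
/-- The Young symmetrizer `c = a * b`, where `a` is the sum of the permutations preserving the
rows of the tableau, and `b` the signed sum of the permutations preserving its columns. -/
def youngSymmetrizer {n : ℕ} (lam : n.Partition) : MonoidAlgebra ℂ (Equiv.Perm (Fin n)) :=
  (∑ g : Equiv.Perm (Fin n) with ∀ i, (tableauCell lam (g i)).1 = (tableauCell lam i).1,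
      MonoidAlgebra.single g 1) *
  (∑ g : Equiv.Perm (Fin n) with ∀ i, (tableauCell lam (g i)).2 = (tableauCell lam i).2,
      MonoidAlgebra.single g ((Equiv.Perm.sign g : ℤ) : ℂ))

/-- The left ideal of `ℂ[𝔖_n]` generated by the Young symmetrizer. -/
abbrev spechtIdeal {n : ℕ} (lam : n.Partition) : Ideal (MonoidAlgebra ℂ (Equiv.Perm (Fin n))) :=
  Ideal.span {youngSymmetrizer lam}

/-- The action of `𝔖_n` on the left ideal by left multiplication. -/
def spechtIdealRep {n : ℕ} (lam : n.Partition) :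
    Representation ℂ (Equiv.Perm (Fin n)) (spechtIdeal lam) :=
  Representation.ofModule' _

/-- The space of the Specht module `[lam]`. -/
def SpechtModule {n : ℕ} (lam : n.Partition) : Type := spechtIdeal lam

instance {n : ℕ} (lam : n.Partition) : AddCommGroup (SpechtModule lam) :=
  inferInstanceAs (AddCommGroup (spechtIdeal lam))

instance {n : ℕ} (lam : n.Partition) : Module ℂ (SpechtModule lam) :=
  inferInstanceAs (Module ℂ (spechtIdeal lam))

/-- The Specht module `[lam]` as a representation of `𝔖_n`. -/
def specht {n : ℕ} (lam : n.Partition) :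
    Representation ℂ (Equiv.Perm (Fin n)) (SpechtModule lam) :=
  spechtIdealRep lam

/-- The partition `(2^p, 1^q)` of `m = 2p + q`. -/
def twoOne {m : ℕ} (p q : ℕ) (h : 2 * p + q = m) : m.Partition where
  parts := Multiset.replicate p 2 + Multiset.replicate q 1
  parts_pos := by
    intro i hi
    rcases Multiset.mem_add.1 hi with hi | hi
    · rw [Multiset.eq_of_mem_replicate hi]; norm_num
    · rw [Multiset.eq_of_mem_replicate hi]; norm_num
  parts_sum := by simp; omega

/-- The one-row partition `(m)`; `[m]` is the trivial representation of `𝔖_m`. -/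
abbrev row (m : ℕ) : m.Partition := Nat.Partition.indiscrete m

/-- The one-column partition `(1^m)`; `[1^m]` is the sign representation of `𝔖_m`. -/
abbrev col (m : ℕ) : m.Partition := twoOne 0 m (by omega)

/-! ### The group `G_n` and its representations attached to a multidegree -/

/-- The group `G_n = 𝔖_n ⋉ (ℂ^*)^n`, in which `𝔖_n` acts on the torus by
`(σ t)_i = t_{σ⁻¹ i}`. -/
abbrev G (n : ℕ) : Type := (Fin n → ℂˣ) ⋊[mulAutArrow] Equiv.Perm (Fin n)

/-- The character `t ↦ ∏ t_i ^ {d_i}` of the torus, for a multidegree `d ∈ ℤ^n`. -/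
def torusChar {n : ℕ} (d : Fin n → ℤ) : (Fin n → ℂˣ) →* ℂˣ where
  toFun t := ∏ i, t i ^ d i
  map_one' := by simp
  map_mul' s t := by simp [mul_zpow, Finset.prod_mul_distrib]

/-- For a homomorphism `φ : H → 𝔖_n`, the group `H ⋉ (ℂ^*)^n`. -/
abbrev TorusExt {n : ℕ} {H : Type*} [Group H] (φ : H →* Equiv.Perm (Fin n)) : Type _ :=
  (Fin n → ℂˣ) ⋊[mulAutArrow.comp φ] H

/-- The natural homomorphism `H ⋉ (ℂ^*)^n → 𝔖_n ⋉ (ℂ^*)^n = G_n`. -/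
def torusExtHom {n : ℕ} {H : Type*} [Group H] (φ : H →* Equiv.Perm (Fin n)) :
    TorusExt φ →* G n :=
  SemidirectProduct.map (MonoidHom.id _) φ (fun _ => rfl)

/-- The representation `ρ ⊗ χ_d` of `H ⋉ (ℂ^*)^n`, for `H → 𝔖_n` stabilizing the multidegree
`d` and a representation `ρ` of `H`. -/
def twist {n : ℕ} {H : Type*} [Group H] (φ : H →* Equiv.Perm (Fin n)) (d : Fin n → ℤ)
    (hd : ∀ h i, d (φ h i) = d i) {M : Type*} [AddCommGroup M] [Module ℂ M]
    (ρ : Representation ℂ H M) : Representation ℂ (TorusExt φ) M where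
  toFun x := ((torusChar d x.left : ℂˣ) : ℂ) • ρ x.right
  map_one' := by simp
  map_mul' x y := by
    have key : torusChar d (mulAutArrow (φ x.right) y.left) = torusChar d y.left := by
      simp only [torusChar, MonoidHom.coe_mk, OneHom.coe_mk]
      refine Fintype.prod_equiv (φ x.right)⁻¹ _ _ fun i => ?_
      have h := hd x.right ((φ x.right)⁻¹ i)
      rw [← Equiv.Perm.mul_apply, mul_inv_cancel, Equiv.Perm.one_apply] at h
      rw [h]
      rfl
    simp only [SemidirectProduct.mul_left, SemidirectProduct.mul_right, map_mul,
      MonoidHom.comp_apply, key, Units.val_mul]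
    ext v
    simp only [LinearMap.smul_apply, Module.End.mul_apply, map_smul, smul_smul]
    rw [mul_comm]

/-- The `G_n`-representation induced from the representation `ρ ⊗ χ_d` of `H ⋉ (ℂ^*)^n`. -/
def orbitRep {n : ℕ} {H : Type*} [Group H] (φ : H →* Equiv.Perm (Fin n)) (d : Fin n → ℤ)
    (hd : ∀ h i, d (φ h i) = d i) {M : Type*} [AddCommGroup M] [Module ℂ M]
    (ρ : Representation ℂ H M) :
    Representation ℂ (G n) (IndSpace (torusExtHom φ) (twist φ d hd ρ)) :=
  ind (torusExtHom φ) (twist φ d hd ρ)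

/-- The multidegree `(d₁^p, d₂^q, d₃^{n-p-q})`. -/
def blockDeg (n p q : ℕ) (d₁ d₂ d₃ : ℤ) : Fin n → ℤ :=
  fun i => if (i : ℕ) < p then d₁ else if (i : ℕ) < p + q then d₂ else d₃

lemma young₂_lt {p q m : ℕ} (h : p + q = m) (x : Equiv.Perm (Fin p) × Equiv.Perm (Fin q))
    (i : Fin p) : young₂ h x (finCongr h (Fin.castAdd q i)) =
      finCongr h (Fin.castAdd q (x.1 i)) := by
  simp [young₂, Equiv.permCongrHom, Equiv.permCongr_apply]

lemma young₂_ge {p q m : ℕ} (h : p + q = m) (x : Equiv.Perm (Fin p) × Equiv.Perm (Fin q))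
    (i : Fin q) : young₂ h x (finCongr h (Fin.natAdd p i)) =
      finCongr h (Fin.natAdd p (x.2 i)) := by
  simp [young₂, Equiv.permCongrHom, Equiv.permCongr_apply]

lemma blockDeg_young₃ {p q r n : ℕ} (h : p + (q + r) = n) (d₁ d₂ d₃ : ℤ)
    (x : Equiv.Perm (Fin p) × Equiv.Perm (Fin q) × Equiv.Perm (Fin r)) (i : Fin n) :
    blockDeg n p q d₁ d₂ d₃ (young₃ h x i) = blockDeg n p q d₁ d₂ d₃ i := by
  subst h
  induction i using Fin.addCases with
  | left i =>
    have := young₂_lt (rfl : p + (q + r) = _) (x.1, young₂ rfl x.2) i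
    simp only [finCongr_refl, Equiv.refl_apply] at this
    simp [young₃, blockDeg, this, Prod.map]
  | right i =>
    have := young₂_ge (rfl : p + (q + r) = _) (x.1, young₂ rfl x.2) i
    simp only [finCongr_refl, Equiv.refl_apply] at this
    induction i using Fin.addCases with
    | left i =>
      have h2 := young₂_lt (rfl : q + r = _) x.2 i
      simp only [finCongr_refl, Equiv.refl_apply] at h2
      simp [young₃, blockDeg, this, h2, Prod.map]
    | right i =>
      have h2 := young₂_ge (rfl : q + r = _) x.2 i
      simp only [finCongr_refl, Equiv.refl_apply] at h2
      simp [young₃, blockDeg, this, h2, Prod.map]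

/-- The `G_n`-representation `(ρ₁, ρ₂, ρ₃)_{⟨d₁^p, d₂^q, d₃^r⟩}`, `p + q + r = n`: the induced
representation from `(𝔖_p × 𝔖_q × 𝔖_r) ⋉ (ℂ^*)^n` to `G_n` of
`(ρ₁ ⊠ ρ₂ ⊠ ρ₃) ⊗ χ_{(d₁^p, d₂^q, d₃^r)}`. -/
def orbit₃ {p q r n : ℕ} (h : p + (q + r) = n) (d₁ d₂ d₃ : ℤ)
    {M₁ M₂ M₃ : Type*} [AddCommGroup M₁] [Module ℂ M₁] [AddCommGroup M₂] [Module ℂ M₂]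
    [AddCommGroup M₃] [Module ℂ M₃] (ρ₁ : Representation ℂ (Equiv.Perm (Fin p)) M₁)
    (ρ₂ : Representation ℂ (Equiv.Perm (Fin q)) M₂)
    (ρ₃ : Representation ℂ (Equiv.Perm (Fin r)) M₃) :
    Representation ℂ (G n) (IndSpace (torusExtHom (young₃ h))
      (twist (young₃ h) (blockDeg n p q d₁ d₂ d₃) (blockDeg_young₃ h d₁ d₂ d₃)
        (boxtimes ρ₁ (boxtimes ρ₂ ρ₃)))) :=
  orbitRep (young₃ h) (blockDeg n p q d₁ d₂ d₃) (blockDeg_young₃ h d₁ d₂ d₃)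
    (boxtimes ρ₁ (boxtimes ρ₂ ρ₃))

lemma pair_young₂ (d₁ d₂ : ℤ) (x : Equiv.Perm (Fin 1) × Equiv.Perm (Fin 1)) (i : Fin 2) :
    ![d₁, d₂] (young₂ (rfl : 1 + 1 = 2) x i) = ![d₁, d₂] i := by
  have : x = 1 := Subsingleton.elim _ _
  simp [this]

/-- The `G_2`-representation `(ρ₁, ρ₂)_{⟨d₁, d₂⟩}` for representations `ρ₁, ρ₂` of `𝔖_1`. -/
def orbit₁₁ (d₁ d₂ : ℤ) {M₁ M₂ : Type*} [AddCommGroup M₁] [Module ℂ M₁] [AddCommGroup M₂]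
    [Module ℂ M₂] (ρ₁ : Representation ℂ (Equiv.Perm (Fin 1)) M₁)
    (ρ₂ : Representation ℂ (Equiv.Perm (Fin 1)) M₂) :
    Representation ℂ (G 2) (IndSpace (torusExtHom (young₂ (rfl : 1 + 1 = 2)))
      (twist (young₂ (rfl : 1 + 1 = 2)) ![d₁, d₂] (pair_young₂ d₁ d₂) (boxtimes ρ₁ ρ₂))) :=
  orbitRep (young₂ (rfl : 1 + 1 = 2)) ![d₁, d₂] (pair_young₂ d₁ d₂) (boxtimes ρ₁ ρ₂)

/-- The `G_n`-representation `(ρ)_{⟨d^n⟩}` for a representation `ρ` of `𝔖_n`. -/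
def orbit₁ (n : ℕ) (d : ℤ) {M : Type*} [AddCommGroup M] [Module ℂ M]
    (ρ : Representation ℂ (Equiv.Perm (Fin n)) M) :
    Representation ℂ (G n)
      (IndSpace (torusExtHom (MonoidHom.id (Equiv.Perm (Fin n))))
        (twist (MonoidHom.id (Equiv.Perm (Fin n))) (fun _ => d) (fun _ _ => rfl) ρ)) :=
  orbitRep (MonoidHom.id (Equiv.Perm (Fin n))) (fun _ => d) (fun _ _ => rfl) ρ

/-! ### The exterior algebra of `(V ⊗ W)^*` and its multigraded pieces -/

/-- The action of `G_n` on `V = ℂ^n`, where `v_i` has multidegree `-𝐞_i`: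
a permutation `σ` sends `v_i` to `v_{σ i}`, and `t` in the torus sends `v_i` to `t_i⁻¹ v_i`. -/
def stdRep (n : ℕ) : Representation ℂ (G n) (Fin n → ℂ) where
  toFun x :=
    { toFun := fun v i => (((x.left i)⁻¹ : ℂˣ) : ℂ) * v (x.right⁻¹ i)
      map_add' := fun v w => by ext i; simp [mul_add]
      map_smul' := fun c v => by ext i; simp [mul_left_comm] }
  map_one' := by ext v i; simp
  map_mul' x y := by
    refine LinearMap.ext fun v => funext fun i => ?_
    have h : (x * y).left i = x.left i * y.left (x.right⁻¹ i) := rfl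
    have h' : (x * y).right⁻¹ i = y.right⁻¹ (x.right⁻¹ i) := by
      rw [SemidirectProduct.mul_right, mul_inv_rev, Equiv.Perm.mul_apply]
    simp only [LinearMap.coe_mk, AddHom.coe_mk, Module.End.mul_apply, h, h', mul_inv,
      Units.val_mul, mul_assoc]

/-- The space `(V ⊗ W)^*` with `V = ℂ^n` and `W = ℂ^2`. -/
abbrev DualVW (n : ℕ) : Type := Module.Dual ℂ ((Fin n → ℂ) ⊗[ℂ] (Fin 2 → ℂ))

/-- The representation of `G_n × G_2` on `A = ⋀ (V ⊗ W)^*` by algebra automorphisms, induced by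
the contragredient of its action on `V ⊗ W`. -/
def extRep (n : ℕ) : Representation ℂ (G n × G 2) (ExteriorAlgebra ℂ (DualVW n)) where
  toFun x := (ExteriorAlgebra.map
    ((boxtimes (stdRep n) (stdRep 2)).dual x)).toLinearMap
  map_one' := by
    rw [map_one]
    change (ExteriorAlgebra.map LinearMap.id).toLinearMap = _
    rw [ExteriorAlgebra.map_id]
    rfl
  map_mul' x y := by
    rw [map_mul]
    change (ExteriorAlgebra.map (LinearMap.comp _ _)).toLinearMap = _
    rw [← ExteriorAlgebra.map_comp_map]
    rfl

/-- The component `B_{(d, e)}` of multidegree `(d, e) ∈ ℤ^n × ℤ^m` of a representation `B` of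
`G_n × G_m`. -/
def weightSpace {n m : ℕ} {B : Type*} [AddCommGroup B] [Module ℂ B]
    (ρ : Representation ℂ (G n × G m) B) (d : Fin n → ℤ) (e : Fin m → ℤ) : Submodule ℂ B where
  carrier := {v | ∀ (s : Fin n → ℂˣ) (t : Fin m → ℂˣ),
    ρ (SemidirectProduct.inl s, SemidirectProduct.inl t) v =
      ((torusChar d s * torusChar e t : ℂˣ) : ℂ) • v}
  add_mem' hv hw s t := by rw [map_add, hv, hw, smul_add]
  zero_mem' s t := by simp
  smul_mem' c v hv s t := by rw [map_smul, hv, smul_comm]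

lemma inl_mul_eq {n : ℕ} (g : G n) (s : Fin n → ℂˣ) :
    (SemidirectProduct.inl s : G n) * g =
      g * SemidirectProduct.inl (mulAutArrow g.right⁻¹ (g.left⁻¹ * s * g.left)) := by
  ext1
  · rw [SemidirectProduct.mul_left, SemidirectProduct.mul_left, SemidirectProduct.left_inl,
      SemidirectProduct.left_inl, SemidirectProduct.right_inl, ← MulAut.mul_apply, ← map_mul,
      mul_inv_cancel, map_one, MulAut.one_apply, MulAut.one_apply, mul_assoc,
      mul_inv_cancel_left]
  · simp

lemma torusChar_conj {n : ℕ} (g : G n) (d : Fin n → ℤ) (s : Fin n → ℂˣ) :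
    torusChar d (mulAutArrow g.right⁻¹ (g.left⁻¹ * s * g.left)) =
      torusChar (fun i => d (g.right⁻¹ i)) s := by
  rw [mul_comm g.left⁻¹ s, inv_mul_cancel_right]
  simp only [torusChar, MonoidHom.coe_mk, OneHom.coe_mk]
  refine Fintype.prod_equiv g.right _ _ fun i => ?_
  simp [mulAutArrow]
  rfl

lemma weightSpace_map {n m : ℕ} {B : Type*} [AddCommGroup B] [Module ℂ B]
    (ρ : Representation ℂ (G n × G m) B) (d : Fin n → ℤ) (e : Fin m → ℤ) (g : G n × G m)
    {v : B} (hv : v ∈ weightSpace ρ d e) :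
    ρ g v ∈ weightSpace ρ (fun i => d (g.1.right⁻¹ i)) (fun j => e (g.2.right⁻¹ j)) := by
  intro s t
  have h : ((SemidirectProduct.inl s, SemidirectProduct.inl t) : G n × G m) * g =
      g * (SemidirectProduct.inl (mulAutArrow g.1.right⁻¹ (g.1.left⁻¹ * s * g.1.left)),
        SemidirectProduct.inl (mulAutArrow g.2.right⁻¹ (g.2.left⁻¹ * t * g.2.left))) :=
    Prod.ext (inl_mul_eq g.1 s) (inl_mul_eq g.2 t)
  rw [← Module.End.mul_apply, ← map_mul, h, map_mul, Module.End.mul_apply, hv, map_smul,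
    torusChar_conj, torusChar_conj]

/-- The representation `B_{⟨(d, e)⟩}`: the sum of the components of `B` over all multidegrees in
the `𝔖_n × 𝔖_m`-orbit of `(d, e)`. -/
def orbitPiece {n m : ℕ} {B : Type*} [AddCommGroup B] [Module ℂ B]
    (ρ : Representation ℂ (G n × G m) B) (d : Fin n → ℤ) (e : Fin m → ℤ) :
    Subrepresentation ρ where
  toSubmodule := ⨆ x : Equiv.Perm (Fin n) × Equiv.Perm (Fin m),
    weightSpace ρ (fun i => d (x.1 i)) (fun j => e (x.2 j))
  apply_mem_toSubmodule := by
    intro g v hv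
    refine Submodule.iSup_induction _ (motive := fun v => ρ g v ∈ ⨆ x : Equiv.Perm (Fin n) × Equiv.Perm (Fin m),
      weightSpace ρ (fun i => d (x.1 i)) (fun j => e (x.2 j))) hv ?_ ?_ ?_
    · intro x w hw
      have h := weightSpace_map ρ _ _ g hw
      exact Submodule.mem_iSup_of_mem (x * (g.1.right⁻¹, g.2.right⁻¹)) h
    · rw [map_zero]
      exact Submodule.zero_mem _
    · intro w₁ w₂ h₁ h₂
      rw [map_add]
      exact Submodule.add_mem _ h₁ h₂

end TorusSym

end

open TorusSym

/-! The components of different multidegrees are independent, and `𝔖_n × 𝔖_2` permutes those in one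
orbit transitively. Hence `A_⟨d⟩` is induced from `A_d`, regarded as a representation of the
stabilizer of `d` in `G_n × G_2`, and only the action of that stabilizer on `A_d` has to be
identified. `nonempty_equiv_orbitPiece` is this reduction; `nonempty_equiv_boxtimes_orbitRep` and
`nonempty_equiv_directSum_boxtimes_orbitRep` give it the form used in the two cases.

Let `x_{i,j}` be the coordinates on `V ⊗ W`, and put `r = n - a - b`. A monomial of row degree
`(2^a, 1^b, 0^r)` contains both coordinates of each row of the first block, exactly one of each row
of the second and none of the third. It is determined by the set `J` of rows of the second block
that contribute `x_{i,1}`, and the column degree says that `|J| = c`. So `A_d` is the space of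
functions on the `c`-element subsets of a set with `b` elements (`blockMap_injective`,
`range_blockMap`). The products `x_{i,0} x_{i,1}` commute, so `𝔖_a` acts trivially, as does `𝔖_r`;
`𝔖_b` moves `J` and picks up its sign from reordering `b` odd factors. The functions on subsets
twisted by the sign are `Ind([1^{b-c}], [1^c])` (`exists_indPair_col_equiv`). If `2c ≠ b`, the
stabilizer of the column degree in `𝔖_2` is trivial and this is all.

If `b = 2c`, the transposition of `𝔖_2` also acts on `A_d`: it replaces `J` by its complement and
multiplies by `(-1)^a` (`blockMap_complMap`). Let `y_s` be the indicator function of `s ∈ J`. The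
Young symmetrizer of `(2^p, 1^{2c-2p})`, applied to the indicator function of the subsets containing
the second column, gives a nonzero multiple of `∏ (y_{r i} - y_{l i})` over the `p` rows of length
two. This maps each Specht module to functions. Summing a function over the supersets of `p`-element
subsets shows that the maps are jointly injective (`spechtSumMap_injective`), and they are jointly
surjective because these products span (`span_pairProd`); neither irreducibility nor a dimension
count is needed. Complementation sends `y_s` to `1 - y_s`, hence is `(-1)^p` on the image
(`complMap_spechtMap`). With `p = c - j` the total sign `(-1)^{a+c-j}` is that of
`[1^2]^{⊗(a+c-j)}`. -/

noncomputable section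

namespace TorusSym

/-! ### Maps out of induced representations -/

section Induction

variable {G H M B : Type*} [Group G] [Group H] [AddCommGroup M] [Module ℂ M]
  [AddCommGroup B] [Module ℂ B]

/-- The class of `h ⊗ m` in the induced representation. -/
def indMk (φ : G →* H) (ρ : Representation ℂ G M) (h : H) : M →ₗ[ℂ] IndSpace φ ρ :=
  Representation.IndV.mk φ ρ h

lemma ind_indMk (φ : G →* H) (ρ : Representation ℂ G M) (h k : H) (m : M) :
    ind φ ρ h (indMk φ ρ k m) = indMk φ ρ (k * h⁻¹) m :=
  Representation.ind_mk φ ρ h k m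

lemma indMk_eq_ind (φ : G →* H) (ρ : Representation ℂ G M) (h : H) (m : M) :
    indMk φ ρ h m = ind φ ρ h⁻¹ (indMk φ ρ 1 m) := by
  rw [ind_indMk, one_mul, inv_inv]

/-- This is the defining relation of the coinvariants, applied to the vector `φ(g)⁻¹ ⊗ m`. It makes
the copy of `M` at the identity stable under the image of `φ`. -/
lemma ind_map_indMk_one (φ : G →* H) (ρ : Representation ℂ G M) (g : G) (m : M) :
    ind φ ρ (φ g) (indMk φ ρ 1 m) = indMk φ ρ 1 (ρ g m) := by
  rw [ind_indMk, one_mul]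
  have h := Representation.Coinvariants.mk_self_apply
    (Representation.tprod ((Representation.leftRegular ℂ H).comp φ) ρ) g
    ((MonoidAlgebra.single (φ g)⁻¹ (1 : ℂ)) ⊗ₜ[ℂ] m)
  have h2 : (Representation.tprod ((Representation.leftRegular ℂ H).comp φ) ρ) g
      ((MonoidAlgebra.single (φ g)⁻¹ (1 : ℂ)) ⊗ₜ[ℂ] m) =
      (MonoidAlgebra.single (1 : H) (1 : ℂ)) ⊗ₜ[ℂ] (ρ g m) := by
    rw [Representation.tprod_apply, TensorProduct.map_tmul]
    congr 1
    simp
  rw [h2] at h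
  exact h.symm

lemma ind_hom_ext {φ : G →* H} {ρ : Representation ℂ G M} {f g : IndSpace φ ρ →ₗ[ℂ] B}
    (h : ∀ k m, f (indMk φ ρ k m) = g (indMk φ ρ k m)) : f = g :=
  Representation.IndV.hom_ext φ ρ fun k => LinearMap.ext fun m => h k m

lemma span_indMk (φ : G →* H) (ρ : Representation ℂ G M) :
    Submodule.span ℂ {x | ∃ k m, x = indMk φ ρ k m} = ⊤ := by
  set S := Submodule.span ℂ {x | ∃ k m, x = indMk φ ρ k m}
  have h : S.mkQ = 0 := ind_hom_ext fun k m => by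
    have hk : indMk φ ρ k m ∈ S := Submodule.subset_span ⟨k, m, rfl⟩
    simpa using hk
  rw [← S.ker_mkQ, h, LinearMap.ker_zero]

/-- The map out of an induced representation given by an equivariant map. -/
def indLift (φ : G →* H) (ρ : Representation ℂ G M) (π : Representation ℂ H B) (f : M →ₗ[ℂ] B)
    (hf : ∀ g m, f (ρ g m) = π (φ g) (f m)) : IndSpace φ ρ →ₗ[ℂ] B :=
  Representation.Coinvariants.lift _
    (TensorProduct.lift <| (Finsupp.lift _ ℂ _ fun h => π h⁻¹ ∘ₗ f) ∘ₗ
      (MonoidAlgebra.coeffLinearEquiv ℂ).toLinearMap)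
    fun g ↦ by
      ext h x
      simp only [LinearMap.coe_comp, Function.comp_apply, MonoidAlgebra.lsingle_apply]
      simp [hf]

lemma indLift_indMk (φ : G →* H) (ρ : Representation ℂ G M) (π : Representation ℂ H B)
    (f : M →ₗ[ℂ] B) (hf : ∀ g m, f (ρ g m) = π (φ g) (f m)) (k : H) (m : M) :
    indLift φ ρ π f hf (indMk φ ρ k m) = π k⁻¹ (f m) := by
  change (Representation.Coinvariants.lift _ _ _) (Representation.Coinvariants.mk _ _) = _
  simp

lemma indLift_ind (φ : G →* H) (ρ : Representation ℂ G M) (π : Representation ℂ H B)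
    (f : M →ₗ[ℂ] B) (hf : ∀ g m, f (ρ g m) = π (φ g) (f m)) (h : H) (x : IndSpace φ ρ) :
    indLift φ ρ π f hf (ind φ ρ h x) = π h (indLift φ ρ π f hf x) := by
  suffices (indLift φ ρ π f hf) ∘ₗ (ind φ ρ h) = π h ∘ₗ (indLift φ ρ π f hf) from
    LinearMap.congr_fun this x
  refine ind_hom_ext fun k m => ?_
  simp [ind_indMk, indLift_indMk]

variable {G' H' M' : Type*} [Group G'] [Group H'] [AddCommGroup M'] [Module ℂ M']

lemma boxtimes_tmul (ρ : Representation ℂ G M) (σ : Representation ℂ G' M') (g : G) (g' : G')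
    (m : M) (m' : M') : boxtimes ρ σ (g, g') (m ⊗ₜ m') = ρ g m ⊗ₜ σ g' m' := rfl

/-- The map out of an external product of two induced representations given by an equivariant
map. -/
theorem exists_boxtimes_ind_lift (φ : G →* H) (ψ : G' →* H') (ρ : Representation ℂ G M)
    (σ : Representation ℂ G' M') (π : Representation ℂ (H × H') B) (f : M ⊗[ℂ] M' →ₗ[ℂ] B)
    (hf : ∀ g g' m m', f (ρ g m ⊗ₜ σ g' m') = π (φ g, ψ g') (f (m ⊗ₜ m'))) :
    ∃ F : IndSpace φ ρ ⊗[ℂ] IndSpace ψ σ →ₗ[ℂ] B,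
      (∀ h x, F (boxtimes (ind φ ρ) (ind ψ σ) h x) = π h (F x)) ∧
      ∀ m m', F (indMk φ ρ 1 m ⊗ₜ indMk ψ σ 1 m') = f (m ⊗ₜ m') := by
  let π₂ : Representation ℂ H' B := π.comp (MonoidHom.inr H H')
  have hf₂ (m : M) (g' m') : (f ∘ₗ TensorProduct.mk ℂ M M' m) (σ g' m') =
      π₂ (ψ g') ((f ∘ₗ TensorProduct.mk ℂ M M' m) m') := by
    have := hf 1 g' m m'
    simpa [π₂] using this
  -- The lift is done one factor at a time: for fixed `m` extend over the second induced space, then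
  -- extend the resulting map on `M` over the first, with `H` acting on linear maps into `B` by
  -- postcomposition.
  let f₁ : M →ₗ[ℂ] (IndSpace ψ σ →ₗ[ℂ] B) :=
    { toFun := fun m => indLift ψ σ π₂ (f ∘ₗ TensorProduct.mk ℂ M M' m) (hf₂ m)
      map_add' := fun m₁ m₂ => ind_hom_ext fun k m => by
        simp [indLift_indMk]
      map_smul' := fun c m₂ => ind_hom_ext fun k m => by
        simp [indLift_indMk] }
  let π₁ : Representation ℂ H (IndSpace ψ σ →ₗ[ℂ] B) :=
    { toFun := fun h => LinearMap.compRight ℂ (π (h, 1))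
      map_one' := by
        rw [show ((1 : H), (1 : H')) = 1 from rfl, map_one]; rfl
      map_mul' := fun h k => by
        rw [show ((h * k : H), (1 : H')) = (h, 1) * (k, 1) by simp, map_mul]; rfl }
  have hf₁ (g m) : f₁ (ρ g m) = π₁ (φ g) (f₁ m) := by
    refine ind_hom_ext fun k m' => ?_
    have h1 := hf g 1 m m'
    simp only [map_one, Module.End.one_apply] at h1
    simp only [f₁, π₁, LinearMap.coe_mk, AddHom.coe_mk, indLift_indMk, LinearMap.coe_comp,
      Function.comp_apply, TensorProduct.mk_apply, h1, MonoidHom.coe_mk, OneHom.coe_mk,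
      LinearMap.compRight_apply, π₂, MonoidHom.comp_apply, MonoidHom.inr_apply]
    rw [← Module.End.mul_apply, ← Module.End.mul_apply, ← map_mul, ← map_mul]
    simp
  have key (k m k' m') : TensorProduct.lift (indLift φ ρ π₁ f₁ hf₁)
      (indMk φ ρ k m ⊗ₜ indMk ψ σ k' m') = π (k⁻¹, k'⁻¹) (f (m ⊗ₜ m')) := by
    rw [TensorProduct.lift.tmul, indLift_indMk]
    change π (k⁻¹, 1) (indLift ψ σ π₂ (f ∘ₗ TensorProduct.mk ℂ M M' m) (hf₂ m)
      (indMk ψ σ k' m')) = _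
    rw [indLift_indMk]
    change π (k⁻¹, 1) (π (1, k'⁻¹) (f (m ⊗ₜ m'))) = _
    rw [← Module.End.mul_apply, ← map_mul]
    simp
  refine ⟨TensorProduct.lift (indLift φ ρ π₁ f₁ hf₁), ?_, ?_⟩
  · rintro ⟨h, h'⟩ x
    suffices (TensorProduct.lift (indLift φ ρ π₁ f₁ hf₁)) ∘ₗ
        (boxtimes (ind φ ρ) (ind ψ σ) (h, h')) =
        π (h, h') ∘ₗ (TensorProduct.lift (indLift φ ρ π₁ f₁ hf₁)) from LinearMap.congr_fun this x
    refine TensorProduct.ext (ind_hom_ext fun k m => ind_hom_ext fun k' m' => ?_)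
    change TensorProduct.lift (indLift φ ρ π₁ f₁ hf₁)
      (boxtimes (ind φ ρ) (ind ψ σ) (h, h') (indMk φ ρ k m ⊗ₜ indMk ψ σ k' m')) =
      π (h, h') (TensorProduct.lift (indLift φ ρ π₁ f₁ hf₁) (indMk φ ρ k m ⊗ₜ indMk ψ σ k' m'))
    rw [boxtimes_tmul, ind_indMk, ind_indMk, key, key, ← Module.End.mul_apply, ← map_mul]
    simp
  · intro m m'
    have h1 : ((1 : H)⁻¹, (1 : H')⁻¹) = 1 := by simp
    rw [key, h1, map_one, Module.End.one_apply]

end Induction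

/-! ### Representations generated by a component of a grading -/

/-- An equivariant map between representations is injective if it is injective on a generating
subspace, and the translates of the image of that subspace are independent. -/
theorem injective_of_graded {K P Q B O : Type*} [Group K] [AddCommGroup P] [Module ℂ P]
    [AddCommGroup Q] [Module ℂ Q] [AddCommGroup B] [Module ℂ B]
    (ρQ : Representation ℂ K Q) (ρB : Representation ℂ K B) (F : Q →ₗ[ℂ] B)
    (hF : ∀ k q, F (ρQ k q) = ρB k (F q)) (L : P →ₗ[ℂ] Q) (w : K → O) (Bw : O → Submodule ℂ B)
    (indep : iSupIndep Bw)
    (hL : ∀ k k', w k = w k' → ∀ p, ∃ p', ρQ k (L p) = ρQ k' (L p'))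
    (hw : ∀ k p, ρB k (F (L p)) ∈ Bw (w k))
    (inj : Function.Injective (F ∘ₗ L))
    (span : ⨆ k, (LinearMap.range L).map (ρQ k) = ⊤) : Function.Injective F := by
  classical
  rw [injective_iff_map_eq_zero]
  intro q hq
  -- One translate per label is enough: by `hL` the translate of the generating subspace by `k`
  -- depends only on `w k`. After this choice distinct translates have distinct labels, so
  -- independence can be used.
  let s : Set.range w → K := fun o => o.2.choose
  have hs (o : Set.range w) : w (s o) = o := o.2.choose_spec
  have span' : ⨆ o, (LinearMap.range L).map (ρQ (s o)) = ⊤ := by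
    rw [eq_top_iff, ← span, iSup_le_iff]
    rintro k _ ⟨_, ⟨p, rfl⟩, rfl⟩
    obtain ⟨p', hp'⟩ := hL k (s ⟨w k, k, rfl⟩) (hs ⟨w k, k, rfl⟩).symm p
    exact Submodule.mem_iSup_of_mem ⟨w k, k, rfl⟩ ⟨_, ⟨p', rfl⟩, hp'.symm⟩
  have hmem : q ∈ ⨆ o, (LinearMap.range L).map (ρQ (s o)) := span' ▸ Submodule.mem_top
  obtain ⟨v, hv, rfl⟩ := (Submodule.mem_iSup_iff_exists_finsupp _ _).1 hmem
  have hFv (o : Set.range w) : F (v o) ∈ Bw o := by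
    obtain ⟨_, ⟨p, rfl⟩, hp⟩ := hv o
    rw [← hp, hF, ← hs o]
    exact hw _ _
  have indep' : iSupIndep fun o : Set.range w => Bw o := indep.comp Subtype.val_injective
  have hz : ∀ o ∈ v.support, F (v o) = 0 := by
    rw [Finsupp.sum, map_sum] at hq
    exact (iSupIndep_iff_finsetSum_eq_zero_imp_eq_zero _).1 indep' v.support
      (fun o => F (v o)) (fun o _ => hFv o) hq
  refine Finset.sum_eq_zero fun o ho => ?_
  obtain ⟨_, ⟨p, rfl⟩, hp⟩ := hv o
  have h0 := hz o ho
  rw [← hp, hF] at h0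
  -- Undoing the translation brings the vanishing back to the generating subspace, where injectivity
  -- is known.
  have h1 : F (L p) = 0 := by
    have := congrArg (ρB (s o)⁻¹) h0
    simpa [← Module.End.mul_apply, ← map_mul] using this
  have hp0 : p = 0 := inj (by simpa using h1)
  rw [← hp, hp0]
  simp

/-! ### Independence of the components of different multidegrees -/

lemma torusChar_mulSingle {n : ℕ} (d : Fin n → ℤ) (i : Fin n) (u : ℂˣ) :
    torusChar d (Pi.mulSingle i u) = u ^ d i := by
  classical
  change ∏ j, (Pi.mulSingle i u : Fin n → ℂˣ) j ^ d j = _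
  rw [Finset.prod_eq_single i]
  · simp
  · intro j _ hj
    simp [Pi.mulSingle_eq_of_ne hj]
  · simp

/-- Evaluating at the torus element with a single entry `2` recovers each exponent, as the powers of
the real number `2` are distinct. -/
lemma torusChar_injective (n : ℕ) : Function.Injective (torusChar (n := n)) := by
  intro d d' h
  funext i
  have h1 := congrArg (fun u : ℂˣ => (u : ℂ)) (DFunLike.congr_fun h
    (Pi.mulSingle i (Units.mk0 (2 : ℂ) two_ne_zero)))
  simp only [torusChar_mulSingle, Units.val_zpow_eq_zpow_val, Units.val_mk0] at h1
  have h2 : ((2 : ℝ) : ℂ) ^ d i = ((2 : ℝ) : ℂ) ^ d' i := by simpa using h1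
  rw [← Complex.ofReal_zpow, ← Complex.ofReal_zpow] at h2
  exact zpow_right_injective₀ (a := (2 : ℝ)) (by norm_num) (by norm_num)
    (Complex.ofReal_injective h2)

/-- The torus acts by commuting operators, whose simultaneous generalized eigenspaces are
independent. Distinct multidegrees give distinct systems of eigenvalues, and each component lies in
the corresponding generalized eigenspace. -/
theorem iSupIndep_weightSpace {n m : ℕ} {B : Type*} [AddCommGroup B] [Module ℂ B]
    (ρ : Representation ℂ (G n × G m) B) :
    iSupIndep fun x : (Fin n → ℤ) × (Fin m → ℤ) => weightSpace ρ x.1 x.2 := by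
  let f : (Fin n → ℂˣ) × (Fin m → ℂˣ) → Module.End ℂ B :=
    fun x => ρ (SemidirectProduct.inl x.1, SemidirectProduct.inl x.2)
  have hcomm (x y) : Commute (f x) (f y) := by
    change f x * f y = f y * f x
    simp only [f, ← map_mul, Prod.mk_mul_mk]
    rw [mul_comm x.1, mul_comm x.2]
  have key := Module.End.independent_iInf_maxGenEigenspace_of_forall_mapsTo f
    fun x y φ => Module.End.mapsTo_maxGenEigenspace_of_comm (hcomm y x) φ
  let χ : (Fin n → ℤ) × (Fin m → ℤ) → (Fin n → ℂˣ) × (Fin m → ℂˣ) → ℂ :=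
    fun x y => ((torusChar x.1 y.1 * torusChar x.2 y.2 : ℂˣ) : ℂ)
  have hχ : Function.Injective χ := by
    rintro ⟨d, e⟩ ⟨d', e'⟩ h
    refine Prod.ext (torusChar_injective n ?_) (torusChar_injective m ?_)
    · refine DFunLike.ext _ _ fun s => Units.ext ?_
      simpa [χ] using congrFun h (s, 1)
    · refine DFunLike.ext _ _ fun s => Units.ext ?_
      simpa [χ] using congrFun h (1, s)
  refine (key.comp hχ).mono fun x v hv => ?_
  simp only [Submodule.mem_iInf, Function.comp_apply]
  intro y
  refine (Module.End.mem_maxGenEigenspace _ _ _).2 ⟨1, ?_⟩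
  rw [pow_one, LinearMap.sub_apply, sub_eq_zero, LinearMap.smul_apply, Module.End.one_apply]
  exact hv y.1 y.2

/-! ### Reduction of an orbit of components to a single component -/

/-- A representation is isomorphic to `B_{⟨(d, e)⟩}` if it is generated by a subspace that is
stable under the stabilizer of `(d, e)` and is mapped isomorphically onto `B_{(d, e)}` by an
equivariant map to `B`. -/
theorem nonempty_equiv_orbitPiece {n m : ℕ} {B P Q : Type*} [AddCommGroup B] [Module ℂ B]
    [AddCommGroup P] [Module ℂ P] [AddCommGroup Q] [Module ℂ Q]
    (ρB : Representation ℂ (G n × G m) B) (ρQ : Representation ℂ (G n × G m) Q)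
    (d : Fin n → ℤ) (e : Fin m → ℤ) (F : Q →ₗ[ℂ] B) (hF : ∀ k q, F (ρQ k q) = ρB k (F q))
    (L : P →ₗ[ℂ] Q)
    (hL : ∀ g : G n × G m, (∀ i, d (g.1.right i) = d i) → (∀ j, e (g.2.right j) = e j) →
      ∀ p, ∃ p', ρQ g (L p) = L p')
    (span : ⨆ k, (LinearMap.range L).map (ρQ k) = ⊤)
    (inj : Function.Injective (F ∘ₗ L))
    (range : LinearMap.range (F ∘ₗ L) = weightSpace ρB d e) :
    Nonempty (Representation.Equiv (orbitPiece ρB d e).toRepresentation ρQ) := by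
  have hmem (p : P) : F (L p) ∈ weightSpace ρB d e := range ▸ ⟨p, rfl⟩
  have hinj : Function.Injective F := by
    -- The label of `g` is the multidegree to which `g` moves `(d, e)`. Equal labels for `k` and
    -- `k'` mean that `k'⁻¹ k` stabilizes `(d, e)`.
    refine injective_of_graded ρQ ρB F hF L
      (fun g => ((fun i => d (g.1.right⁻¹ i), fun j => e (g.2.right⁻¹ j)) :
        (Fin n → ℤ) × (Fin m → ℤ)))
      (fun x => weightSpace ρB x.1 x.2) (iSupIndep_weightSpace ρB) ?_ ?_ inj span
    · intro k k' h p
      obtain ⟨h1, h2⟩ := Prod.ext_iff.1 h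
      have h3 (i) : d ((k'⁻¹ * k).1.right i) = d i := by
        simpa using (congrFun h1 (k.1.right i)).symm
      have h4 (j) : e ((k'⁻¹ * k).2.right j) = e j := by
        simpa using (congrFun h2 (k.2.right j)).symm
      obtain ⟨p', hp'⟩ := hL (k'⁻¹ * k) h3 h4 p
      refine ⟨p', ?_⟩
      rw [← hp', ← Module.End.mul_apply, ← map_mul, mul_inv_cancel_left]
    · exact fun k p => weightSpace_map ρB d e k (hmem p)
  have hrange : LinearMap.range F = (orbitPiece ρB d e).toSubmodule := by
    apply le_antisymm
    · rw [LinearMap.range_eq_map, ← span, Submodule.map_iSup, iSup_le_iff]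
      rintro k _ ⟨_, ⟨_, ⟨p, rfl⟩, rfl⟩, rfl⟩
      rw [hF]
      exact Submodule.mem_iSup_of_mem (k.1.right⁻¹, k.2.right⁻¹)
        (weightSpace_map ρB d e k (hmem p))
    -- A vector of a component in the orbit is carried by a permutation into the component `(d, e)`,
    -- which is in the range already; equivariance carries the preimage back.
    · refine iSup_le fun x v hv => ?_
      let g : G n × G m := (SemidirectProduct.inr x.1, SemidirectProduct.inr x.2)
      have h1 : ρB g v ∈ weightSpace ρB d e := by
        have := weightSpace_map ρB _ _ g hv
        simpa [g] using this
      rw [← range] at h1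
      obtain ⟨p, hp⟩ := h1
      refine ⟨ρQ g⁻¹ (L p), ?_⟩
      rw [hF]
      change ρB g⁻¹ ((F ∘ₗ L) p) = v
      rw [hp, ← Module.End.mul_apply, ← map_mul, inv_mul_cancel, map_one, Module.End.one_apply]
  let E : Q ≃ₗ[ℂ] (orbitPiece ρB d e).toSubmodule :=
    (LinearEquiv.ofInjective F hinj).trans (LinearEquiv.ofEq _ _ hrange)
  refine ⟨Representation.Equiv.symm (Representation.Equiv.mk E fun g => ?_)⟩
  ext q
  exact hF g q

/-- The subspace `M ⊗ N` generates the external product of the representations induced from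
`M` and `N`. -/
lemma iSup_range_indMk_one_tmul {G H M G' H' M' : Type*} [Group G] [Group H] [AddCommGroup M]
    [Module ℂ M] [Group G'] [Group H'] [AddCommGroup M'] [Module ℂ M'] (φ : G →* H)
    (ψ : G' →* H') (ρ : Representation ℂ G M) (σ : Representation ℂ G' M') :
    ⨆ k, (LinearMap.range (TensorProduct.map (indMk φ ρ 1) (indMk ψ σ 1))).map
      (boxtimes (ind φ ρ) (ind ψ σ) k) = ⊤ := by
  rw [eq_top_iff, ← TensorProduct.span_tmul_eq_top, Submodule.span_le]
  set S := ⨆ k, (LinearMap.range (TensorProduct.map (indMk φ ρ 1) (indMk ψ σ 1))).map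
      (boxtimes (ind φ ρ) (ind ψ σ) k)
  have key (k m k' m') : indMk φ ρ k m ⊗ₜ[ℂ] indMk ψ σ k' m' ∈ S := by
    refine Submodule.mem_iSup_of_mem (k⁻¹, k'⁻¹) ⟨_, ⟨m ⊗ₜ m', rfl⟩, ?_⟩
    rw [TensorProduct.map_tmul, boxtimes_tmul, ← indMk_eq_ind, ← indMk_eq_ind]
  rintro _ ⟨x, y, rfl⟩
  have hx : x ∈ Submodule.span ℂ {x | ∃ k m, x = indMk φ ρ k m} :=
    span_indMk φ ρ ▸ Submodule.mem_top
  have hy : y ∈ Submodule.span ℂ {x | ∃ k m, x = indMk ψ σ k m} :=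
    span_indMk ψ σ ▸ Submodule.mem_top
  change x ⊗ₜ[ℂ] y ∈ S
  induction hx using Submodule.span_induction with
  | zero => simp
  | add x x' _ _ hx hx' => rw [TensorProduct.add_tmul]; exact add_mem hx hx'
  | smul c x _ hx => rw [← TensorProduct.smul_tmul']; exact S.smul_mem c hx
  | mem x hx =>
    obtain ⟨k, m, rfl⟩ := hx
    induction hy using Submodule.span_induction with
    | zero => simp
    | add x x' _ _ hx hx' => rw [TensorProduct.tmul_add]; exact add_mem hx hx'
    | smul c x _ hx => rw [TensorProduct.tmul_smul]; exact S.smul_mem c hx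
    | mem y hy =>
      obtain ⟨k', m', rfl⟩ := hy
      exact key k m k' m'

/-! ### Functions on the subsets of a given size -/

/-- The `c`-element subsets of `Fin N`. -/
abbrev Slice (N c : ℕ) : Type := {J : Finset (Fin N) // J.card = c}

/-- The image of a subset under a permutation. -/
def Slice.move {N c : ℕ} (σ : Equiv.Perm (Fin N)) (J : Slice N c) : Slice N c :=
  ⟨J.1.map σ.toEmbedding, by rw [Finset.card_map, J.2]⟩

lemma Slice.mem_move {N c : ℕ} (σ : Equiv.Perm (Fin N)) (J : Slice N c) (i : Fin N) :
    i ∈ (J.move σ).1 ↔ σ⁻¹ i ∈ J.1 := by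
  rw [Slice.move, Finset.mem_map_equiv]; rfl

lemma Slice.ext_mem {N c : ℕ} {J J' : Slice N c} (h : ∀ i, i ∈ J.1 ↔ i ∈ J'.1) : J = J' :=
  Subtype.ext (Finset.ext h)

lemma Slice.move_mul {N c : ℕ} (σ τ : Equiv.Perm (Fin N)) (J : Slice N c) :
    J.move (σ * τ) = (J.move τ).move σ :=
  Slice.ext_mem fun i => by simp [Slice.mem_move]

lemma Slice.move_one {N c : ℕ} (J : Slice N c) : J.move 1 = J :=
  Slice.ext_mem fun i => by simp [Slice.mem_move]

lemma Slice.move_inv_eq_iff {N c : ℕ} (σ : Equiv.Perm (Fin N)) (J J' : Slice N c) :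
    J.move σ⁻¹ = J' ↔ J = J'.move σ := by
  constructor
  · rintro rfl
    rw [← Slice.move_mul, mul_inv_cancel, Slice.move_one]
  · rintro rfl
    rw [← Slice.move_mul, inv_mul_cancel, Slice.move_one]

/-- The sign of a permutation as a complex number. -/
abbrev csign {N : ℕ} (σ : Equiv.Perm (Fin N)) : ℂ := ((Equiv.Perm.sign σ : ℤ) : ℂ)

lemma csign_mul_self {N : ℕ} (σ : Equiv.Perm (Fin N)) : csign σ * csign σ = 1 := by
  rcases Int.units_eq_one_or (Equiv.Perm.sign σ) with h | h <;> simp [csign, h]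

lemma csign_mul {N : ℕ} (σ τ : Equiv.Perm (Fin N)) : csign (σ * τ) = csign σ * csign τ := by
  simp [csign]

/-- The representation of `𝔖_N` on functions on the `c`-element subsets, twisted by the sign. -/
def sliceRep (N c : ℕ) : Representation ℂ (Equiv.Perm (Fin N)) (Slice N c → ℂ) where
  toFun σ :=
    { toFun := fun f J => csign σ * f (J.move σ⁻¹)
      map_add' := fun f g => by ext J; simp [mul_add]
      map_smul' := fun c f => by ext J; simp [mul_left_comm] }
  map_one' := by ext; simp [Slice.move_one, csign]
  map_mul' σ τ := by
    refine LinearMap.ext fun f => funext fun J => ?_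
    simp only [LinearMap.coe_mk, AddHom.coe_mk, Module.End.mul_apply, csign_mul, mul_inv_rev,
      Slice.move_mul, mul_assoc]

lemma sliceRep_apply {N c : ℕ} (σ : Equiv.Perm (Fin N)) (f : Slice N c → ℂ) (J : Slice N c) :
    sliceRep N c σ f J = csign σ * f (J.move σ⁻¹) := rfl

lemma sliceRep_single {N c : ℕ} (σ : Equiv.Perm (Fin N)) (J : Slice N c) (u : ℂ) :
    sliceRep N c σ (Pi.single J u) = csign σ • Pi.single (J.move σ) u := by
  classical
  funext J'
  simp [sliceRep_apply, Pi.single_apply, Slice.move_inv_eq_iff]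

/-- The sum of the values of a function on the `c`-element subsets containing a given
`p`-element subset. -/
def sliceSum (N c p : ℕ) : (Slice N c → ℂ) →ₗ[ℂ] (Slice N p → ℂ) where
  toFun f S := ∑ J : Slice N c with S.1 ⊆ J.1, f J
  map_add' f g := by ext S; simp [Finset.sum_add_distrib]
  map_smul' c f := by ext S; simp [Finset.mul_sum]

lemma sliceSum_apply {N c p : ℕ} (f : Slice N c → ℂ) (S : Slice N p) :
    sliceSum N c p f S = ∑ J : Slice N c with S.1 ⊆ J.1, f J := rfl

lemma sliceSum_sliceRep {N c p : ℕ} (σ : Equiv.Perm (Fin N)) (f : Slice N c → ℂ) :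
    sliceSum N c p (sliceRep N c σ f) = sliceRep N p σ (sliceSum N c p f) := by
  funext S
  rw [sliceRep_apply, sliceSum_apply, sliceSum_apply, Finset.mul_sum]
  refine Finset.sum_nbij' (fun J => J.move σ⁻¹) (fun J => J.move σ) ?_ ?_ ?_ ?_ ?_
  · intro J hJ
    simp only [Finset.mem_filter, Finset.mem_univ, true_and] at hJ ⊢
    intro i hi
    rw [Slice.mem_move] at hi ⊢
    exact hJ hi
  · intro J hJ
    simp only [Finset.mem_filter, Finset.mem_univ, true_and] at hJ ⊢
    intro i hi
    rw [Slice.mem_move]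
    apply hJ
    rw [Slice.mem_move]
    simpa using hi
  · intro J _
    rw [← Slice.move_mul, mul_inv_cancel, Slice.move_one]
  · intro J _
    rw [← Slice.move_mul, inv_mul_cancel, Slice.move_one]
  · intro J _
    rfl

lemma sliceSum_asAlgebraHom {N c p : ℕ} (x : MonoidAlgebra ℂ (Equiv.Perm (Fin N)))
    (f : Slice N c → ℂ) :
    sliceSum N c p ((sliceRep N c).asAlgebraHom x f) =
      (sliceRep N p).asAlgebraHom x (sliceSum N c p f) := by
  induction x using MonoidAlgebra.induction_on with
  | of σ => simp [Representation.asAlgebraHom_single, sliceSum_sliceRep, MonoidAlgebra.of_apply]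
  | add x y hx hy => simp [hx, hy]
  | smul u x hx => simp [hx]

/-! ### Products of differences of indicator functions -/

/-- The indicator function of the subsets containing `s`. -/
def memInd {N : ℕ} (s : Fin N) (J : Finset (Fin N)) : ℂ := if s ∈ J then 1 else 0

lemma memInd_move_inv {N c : ℕ} (σ : Equiv.Perm (Fin N)) (s : Fin N) (J : Slice N c) :
    memInd s (J.move σ⁻¹).1 = memInd (σ s) J.1 := by
  simp [memInd, Slice.mem_move]

/-- `∏ i, (y_{r i} - y_{l i})`, where `y_s` is the indicator function of the subsets
containing `s`. -/
def pairProd {N : ℕ} {p : ℕ} (c : ℕ) (r l : Fin p → Fin N) : Slice N c → ℂ :=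
  fun J => ∏ i, (memInd (r i) J.1 - memInd (l i) J.1)

lemma sliceRep_pairProd {N c p : ℕ} (σ : Equiv.Perm (Fin N)) (r l : Fin p → Fin N) :
    sliceRep N c σ (pairProd c r l) = csign σ • pairProd c (σ ∘ r) (σ ∘ l) := by
  funext J
  simp [sliceRep_apply, pairProd, memInd_move_inv]

/-- The entries of two sequences are distinct. -/
structure DisjointPairs {N p : ℕ} (r l : Fin p → Fin N) : Prop where
  left : Function.Injective r
  right : Function.Injective l
  ne : ∀ i j, r i ≠ l j

lemma swap_apply_of_ne_index {N p : ℕ} {r l : Fin p → Fin N} (h : DisjointPairs r l) {i j : Fin p}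
    (hij : j ≠ i) : Equiv.swap (r i) (l i) (r j) = r j ∧ Equiv.swap (r i) (l i) (l j) = l j :=
  ⟨Equiv.swap_apply_of_ne_of_ne (h.left.ne hij) (h.ne _ _),
    Equiv.swap_apply_of_ne_of_ne (h.ne _ _).symm (h.right.ne hij)⟩

lemma csign_swap {N p : ℕ} {r l : Fin p → Fin N} (h : DisjointPairs r l) (i : Fin p) :
    csign (Equiv.swap (r i) (l i)) = -1 := by
  simp [csign, Equiv.Perm.sign_swap (h.ne i i)]

/-- The transposition negates the factor with index `i` and fixes the others; the sign twist of the
action compensates. -/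
lemma sliceRep_swap_pairProd {N c p : ℕ} {r l : Fin p → Fin N} (h : DisjointPairs r l)
    (i : Fin p) :
    sliceRep N c (Equiv.swap (r i) (l i)) (pairProd c r l) = pairProd c r l := by
  funext J
  rw [sliceRep_pairProd, Pi.smul_apply, csign_swap h]
  simp only [pairProd, Function.comp_apply]
  rw [← Finset.mul_prod_erase _ _ (Finset.mem_univ i),
    ← Finset.mul_prod_erase _ _ (Finset.mem_univ i), Equiv.swap_apply_left,
    Equiv.swap_apply_right, Finset.prod_congr rfl fun j hj => ?_]
  · rw [smul_eq_mul]; ring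
  · obtain ⟨h1, h2⟩ := swap_apply_of_ne_index h (Finset.ne_of_mem_erase hj)
    rw [h1, h2]

/-- A function that is invariant under the transpositions `(r i, l i)` vanishes if it does so on
the subsets containing all `r i` and no `l i`. -/
theorem eq_zero_of_swap_invariant {N c p : ℕ} {r l : Fin p → Fin N} (h : DisjointPairs r l)
    (f : Slice N c → ℂ) (hf : ∀ i, sliceRep N c (Equiv.swap (r i) (l i)) f = f)
    (h0 : ∀ J : Slice N c, (∀ i, r i ∈ J.1 ∧ l i ∉ J.1) → f J = 0) : f = 0 := by
  classical
  -- Because of the sign twist, invariance means that `f` is antisymmetric under exchanging `r i`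
  -- and `l i` in its argument.
  have hf' (i) (J : Slice N c) : f J = - f (J.move (Equiv.swap (r i) (l i))) := by
    have := congrFun (hf i) J
    rw [sliceRep_apply, csign_swap h, Equiv.swap_inv] at this
    rw [← this]; ring
  have hfix (i) (J : Slice N c) (hJ : r i ∈ J.1 ↔ l i ∈ J.1) : f J = 0 := by
    have h1 : J.move (Equiv.swap (r i) (l i)) = J := Slice.ext_mem fun k => by
      rw [Slice.mem_move, Equiv.swap_inv]
      rcases eq_or_ne k (r i) with rfl | h1
      · simp [hJ]
      rcases eq_or_ne k (l i) with rfl | h2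
      · simp [hJ]
      rw [Equiv.swap_apply_of_ne_of_ne h1 h2]
    have := hf' i J
    rw [h1] at this
    exact self_eq_neg.1 this
  -- Each exchange that brings some `r i` into `J` lowers the number of missing `r i`, so the
  -- induction ends at subsets containing all of them. If then some `l i` is also present,
  -- antisymmetry alone gives zero.
  suffices ∀ k (J : Slice N c), (Finset.univ.filter fun i => r i ∉ J.1).card = k → f J = 0 from
    funext fun J => this _ J rfl
  intro k
  induction k using Nat.strong_induction_on with
  | _ k ih =>
  intro J hk
  by_cases hr : ∃ i, r i ∉ J.1
  · obtain ⟨i, hi⟩ := hr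
    by_cases hl : l i ∈ J.1
    · rw [hf' i, ih _ ?_ (J.move (Equiv.swap (r i) (l i))) rfl, neg_zero]
      rw [← hk]
      refine Finset.card_lt_card ⟨fun j hj => ?_, fun hh => ?_⟩
      · simp only [Finset.mem_filter, Finset.mem_univ, true_and, Slice.mem_move,
          Equiv.swap_inv] at hj ⊢
        rcases eq_or_ne j i with rfl | hji
        · exact hi
        · rwa [(swap_apply_of_ne_index h hji).1] at hj
      · have := hh (Finset.mem_filter.2 ⟨Finset.mem_univ i, hi⟩)
        simp [Slice.mem_move, hl] at this
    · exact hfix i J (by simp [hi, hl])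
  · push Not at hr
    by_cases hl : ∃ i, l i ∈ J.1
    · obtain ⟨i, hi⟩ := hl
      exact hfix i J (by simp [hi, hr i])
    · push Not at hl
      exact h0 J fun i => ⟨hr i, hl i⟩

lemma pairProd_eq_one {N c p : ℕ} {r l : Fin p → Fin N} (J : Slice N c)
    (hJ : ∀ i, r i ∈ J.1 ∧ l i ∉ J.1) : pairProd c r l J = 1 := by
  simp [pairProd, memInd, hJ]

/-- The range of a sequence of distinct elements, as a subset. -/
def rangeSlice {N p : ℕ} (r : Fin p → Fin N) (hr : Function.Injective r) : Slice N p :=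
  ⟨Finset.univ.map ⟨r, hr⟩, by simp⟩

lemma mem_rangeSlice {N p : ℕ} (r : Fin p → Fin N) (hr : Function.Injective r) (k : Fin N) :
    k ∈ (rangeSlice r hr).1 ↔ ∃ i, r i = k := by
  simp [rangeSlice]

lemma eq_rangeSlice {N p : ℕ} {r : Fin p → Fin N} (hr : Function.Injective r) {S : Slice N p}
    (hS : ∀ i, r i ∈ S.1) : S = rangeSlice r hr := by
  refine Subtype.ext (Finset.eq_of_subset_of_card_le (fun k hk => ?_) ?_).symm
  · obtain ⟨i, rfl⟩ := (mem_rangeSlice r hr k).1 hk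
    exact hS i
  · rw [S.2, (rangeSlice r hr).2]

/-- The sum inherits the invariance under all `p'` transpositions, so its values on sets containing
every `r i` determine it; a set with fewer than `p'` elements contains no such family. -/
lemma sliceSum_pairProd_of_lt {N c p p' : ℕ} {r l : Fin p' → Fin N} (h : DisjointPairs r l)
    (hp : p < p') : sliceSum N c p (pairProd c r l) = 0 := by
  refine eq_zero_of_swap_invariant h _ (fun i => ?_) fun S hS => ?_
  · rw [← sliceSum_sliceRep, sliceRep_swap_pairProd h]
  · have h1 : (rangeSlice r h.left).1 ⊆ S.1 := fun k hk => by
      obtain ⟨i, rfl⟩ := (mem_rangeSlice r h.left k).1 hk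
      exact (hS i).1
    have := Finset.card_le_card h1
    rw [S.2, (rangeSlice r h.left).2] at this
    omega

/-- Both sides are invariant under the transpositions, and the only relevant `p`-element subset is
the set of the `r i`. Hence they are proportional. The factor `K` counts the `c`-element subsets
that contain all `r i` and no `l i`; the two inequalities ensure that one exists. -/
lemma exists_sliceSum_pairProd {N c p : ℕ} {r l : Fin p → Fin N} (h : DisjointPairs r l)
    (hp : p ≤ c) (hc : c + p ≤ N) :
    ∃ K : ℂ, K ≠ 0 ∧ sliceSum N c p (pairProd c r l) = K • pairProd p r l := by
  classical
  have hS₀ : ∀ i, r i ∈ (rangeSlice r h.left).1 ∧ l i ∉ (rangeSlice r h.left).1 := fun i =>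
    ⟨(mem_rangeSlice r h.left _).2 ⟨i, rfl⟩, fun hi => by
      obtain ⟨j, hj⟩ := (mem_rangeSlice r h.left _).1 hi
      exact h.ne j i hj⟩
  refine ⟨sliceSum N c p (pairProd c r l) (rangeSlice r h.left), ?_, ?_⟩
  · have hterm (J : Slice N c) (hJ : (rangeSlice r h.left).1 ⊆ J.1) :
        pairProd c r l J = if ∀ i, l i ∉ J.1 then 1 else 0 := by
      have hr (i) : r i ∈ J.1 := hJ ((mem_rangeSlice r h.left _).2 ⟨i, rfl⟩)
      split_ifs with hl
      · exact pairProd_eq_one J fun i => ⟨hr i, hl i⟩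
      · push Not at hl
        obtain ⟨i, hi⟩ := hl
        exact Finset.prod_eq_zero (Finset.mem_univ i) (by simp [memInd, hr i, hi])
    rw [sliceSum_apply, Finset.sum_congr rfl fun J hJ => hterm J (Finset.mem_filter.1 hJ).2,
      Finset.sum_boole]
    have hdisj : (rangeSlice r h.left).1 ⊆ (rangeSlice l h.right).1ᶜ := fun k hk => by
      obtain ⟨i, rfl⟩ := (mem_rangeSlice r h.left k).1 hk
      rw [Finset.mem_compl, mem_rangeSlice]
      rintro ⟨j, hj⟩
      exact h.ne i j hj.symm
    obtain ⟨J, hJ1, hJ2, hJ3⟩ := Finset.exists_subsuperset_card_eq hdisj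
      (n := c) (by rw [(rangeSlice r h.left).2]; exact hp)
      (by rw [Finset.card_compl, (rangeSlice l h.right).2, Fintype.card_fin]; omega)
    rw [Nat.cast_ne_zero, ← Nat.pos_iff_ne_zero, Finset.card_pos]
    refine ⟨⟨J, hJ3⟩, ?_⟩
    simp only [Finset.mem_filter, Finset.mem_univ, true_and]
    refine ⟨hJ1, fun i hi => ?_⟩
    exact Finset.mem_compl.1 (hJ2 hi) ((mem_rangeSlice l h.right _).2 ⟨i, rfl⟩)
  · rw [← sub_eq_zero]
    refine eq_zero_of_swap_invariant h _ (fun i => ?_) fun S hS => ?_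
    · rw [map_sub, map_smul, ← sliceSum_sliceRep, sliceRep_swap_pairProd h,
        sliceRep_swap_pairProd h]
    · obtain rfl := eq_rangeSlice h.left fun i => (hS i).1
      rw [Pi.sub_apply, Pi.smul_apply, pairProd_eq_one _ hS, smul_eq_mul, mul_one, sub_self]

lemma DisjointPairs.cons {N p : ℕ} {r l : Fin p → Fin N} (h : DisjointPairs r l) {s t : Fin N}
    (hst : s ≠ t) (hs : ∀ i, s ≠ r i ∧ s ≠ l i) (ht : ∀ i, t ≠ r i ∧ t ≠ l i) :
    DisjointPairs (Fin.cons s r : Fin (p + 1) → Fin N) (Fin.cons t l) where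
  left := Fin.cons_injective_iff.2 ⟨by rintro ⟨i, hi⟩; exact (hs i).1 hi.symm, h.left⟩
  right := Fin.cons_injective_iff.2 ⟨by rintro ⟨i, hi⟩; exact (ht i).2 hi.symm, h.right⟩
  ne i j := by
    induction i using Fin.cases with
    | zero =>
      induction j using Fin.cases with
      | zero => simpa
      | succ j => simpa using (hs j).2
    | succ i =>
      induction j using Fin.cases with
      | zero => simpa using ((ht i).1).symm
      | succ j => simpa using h.ne i j

lemma pairProd_cons {N p : ℕ} (c : ℕ) (r l : Fin p → Fin N) (s t : Fin N) (J : Slice N c) :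
    pairProd c (Fin.cons s r : Fin (p + 1) → Fin N) (Fin.cons t l) J =
      (memInd s J.1 - memInd t J.1) * pairProd c r l J := by
  simp [pairProd, Fin.prod_univ_succ]

/-- On the support of `y_Q ∏ (y_{r i} - y_{l i})`, the number of elements of a `c`-element subset
outside of `Q` and the `r i`, `l i`. -/
lemma sum_memInd_mul {N c p : ℕ} {r l : Fin p → Fin N} (h : DisjointPairs r l)
    (Q : Finset (Fin N)) (hr : ∀ i, r i ∉ Q) (hl : ∀ i, l i ∉ Q) (J : Slice N c)
    (T : Finset (Fin N)) (hT : ∀ t, t ∈ T ↔ t ∉ Q ∧ ∀ i, t ≠ r i ∧ t ≠ l i) :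
    (∑ t ∈ T, memInd t J.1) * (pairProd c r l J * ∏ q ∈ Q, memInd q J.1) =
      ((c : ℂ) - p - Q.card) * (pairProd c r l J * ∏ q ∈ Q, memInd q J.1) := by
  classical
  by_cases h0 : pairProd c r l J * ∏ q ∈ Q, memInd q J.1 = 0
  · rw [h0, mul_zero, mul_zero]
  congr 1
  obtain ⟨h1, h2⟩ := mul_ne_zero_iff.1 h0
  -- Where the product is nonzero, `J` contains exactly one element of each pair and all of `Q`.
  -- Counting the `c` elements of `J` leaves `c - p - |Q|` of them in `T`.
  have hpair (i) : memInd (r i) J.1 + memInd (l i) J.1 = 1 := by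
    have := Finset.prod_ne_zero_iff.1 h1 i (Finset.mem_univ i)
    unfold memInd at this ⊢
    split_ifs at this ⊢ <;> simp_all
  have hQ (q) (hq : q ∈ Q) : memInd q J.1 = 1 := by
    have := Finset.prod_ne_zero_iff.1 h2 q hq
    unfold memInd at this ⊢
    split_ifs at this ⊢ <;> simp_all
  have hall : ∑ t, memInd t J.1 = c := by
    simp only [memInd, Finset.sum_boole]
    rw [Finset.filter_mem_eq_inter, Finset.univ_inter, J.2]
  have hdec : (Finset.univ : Finset (Fin N)) =
      T ∪ (Q ∪ ((rangeSlice r h.left).1 ∪ (rangeSlice l h.right).1)) := by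
    ext t
    simp only [Finset.mem_univ, Finset.mem_union, mem_rangeSlice, hT, true_iff]
    by_cases ha : t ∈ Q
    · exact Or.inr (Or.inl ha)
    by_cases hb : ∃ i, r i = t
    · exact Or.inr (Or.inr (Or.inl hb))
    by_cases hc : ∃ i, l i = t
    · exact Or.inr (Or.inr (Or.inr hc))
    push Not at hb hc
    exact Or.inl ⟨ha, fun i => ⟨(hb i).symm, (hc i).symm⟩⟩
  have hd1 : Disjoint (rangeSlice r h.left).1 (rangeSlice l h.right).1 := by
    rw [Finset.disjoint_left]
    intro t h1 h2
    obtain ⟨i, rfl⟩ := (mem_rangeSlice _ _ _).1 h1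
    obtain ⟨j, hj⟩ := (mem_rangeSlice _ _ _).1 h2
    exact h.ne i j hj.symm
  have hd2 : Disjoint Q ((rangeSlice r h.left).1 ∪ (rangeSlice l h.right).1) := by
    rw [Finset.disjoint_left]
    intro t h1 h2
    rcases Finset.mem_union.1 h2 with h2 | h2
    · obtain ⟨i, rfl⟩ := (mem_rangeSlice _ _ _).1 h2
      exact hr i h1
    · obtain ⟨i, rfl⟩ := (mem_rangeSlice _ _ _).1 h2
      exact hl i h1
  have hd3 : Disjoint T (Q ∪ ((rangeSlice r h.left).1 ∪ (rangeSlice l h.right).1)) := by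
    rw [Finset.disjoint_left]
    intro t h1 h2
    obtain ⟨h3, h4⟩ := (hT t).1 h1
    rcases Finset.mem_union.1 h2 with h2 | h2
    · exact h3 h2
    rcases Finset.mem_union.1 h2 with h2 | h2
    · obtain ⟨i, rfl⟩ := (mem_rangeSlice _ _ _).1 h2
      exact (h4 i).1 rfl
    · obtain ⟨i, rfl⟩ := (mem_rangeSlice _ _ _).1 h2
      exact (h4 i).2 rfl
  rw [hdec, Finset.sum_union hd3, Finset.sum_union hd2, Finset.sum_union hd1,
    Finset.sum_congr rfl hQ] at hall
  have hsum : ∑ t ∈ (rangeSlice r h.left).1, memInd t J.1 +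
      ∑ t ∈ (rangeSlice l h.right).1, memInd t J.1 = p := by
    rw [rangeSlice, rangeSlice, Finset.sum_map, Finset.sum_map, ← Finset.sum_add_distrib]
    simp [hpair]
  rw [hsum, Finset.sum_const, nsmul_eq_mul, mul_one] at hall
  rw [← hall]
  ring

/-- The functions `∏ (y_{r i} - y_{l i})` span the functions on the `c`-element subsets of a set
with `2 c` elements. -/
theorem span_pairProd (c : ℕ) :
    Submodule.span ℂ {f : Slice (2 * c) c → ℂ | ∃ (p : ℕ) (r l : Fin p → Fin (2 * c)),
      p ≤ c ∧ DisjointPairs r l ∧ f = pairProd c r l} = ⊤ := by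
  classical
  set W := Submodule.span ℂ {f : Slice (2 * c) c → ℂ | ∃ (p : ℕ) (r l : Fin p → Fin (2 * c)),
      p ≤ c ∧ DisjointPairs r l ∧ f = pairProd c r l}
  -- The monomial factors `y_s`, `s ∈ Q`, are traded one at a time for difference factors or
  -- scalars. The bound `q + p ≤ c` survives because each step lowers `q` by one and raises `p` by
  -- at most one.
  have key : ∀ (q : ℕ) (Q : Finset (Fin (2 * c))) (p : ℕ) (r l : Fin p → Fin (2 * c)),
      Q.card = q → q + p ≤ c → DisjointPairs r l → (∀ i, r i ∉ Q) → (∀ i, l i ∉ Q) →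
      (fun J => pairProd c r l J * ∏ s ∈ Q, memInd s J.1) ∈ W := by
    intro q
    induction q with
    | zero =>
      intro Q p r l hQ hp h _ _
      obtain rfl := Finset.card_eq_zero.1 hQ
      simp only [Finset.prod_empty, mul_one]
      exact Submodule.subset_span ⟨p, r, l, by omega, h, rfl⟩
    | succ q ih =>
      intro Q p r l hQ hp h hr hl
      obtain ⟨s, hs⟩ : Q.Nonempty := Finset.card_pos.1 (by omega)
      have hQ' : (Q.erase s).card = q := by rw [Finset.card_erase_of_mem hs]; omega
      have hr' (i) : r i ∉ Q.erase s := fun hi => hr i (Finset.mem_of_mem_erase hi)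
      have hl' (i) : l i ∉ Q.erase s := fun hi => hl i (Finset.mem_of_mem_erase hi)
      have hsr (i) : s ≠ r i ∧ s ≠ l i := ⟨fun e => hr i (e ▸ hs), fun e => hl i (e ▸ hs)⟩
      let T : Finset (Fin (2 * c)) :=
        Finset.univ.filter fun t => t ∉ Q.erase s ∧ ∀ i, t ≠ r i ∧ t ≠ l i
      have hT (t) : t ∈ T ↔ t ∉ Q.erase s ∧ ∀ i, t ≠ r i ∧ t ≠ l i := by simp [T]
      have hsT : s ∈ T := (hT s).2 ⟨Finset.notMem_erase s Q, hsr⟩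
      have hT0 : (T.card : ℂ) ≠ 0 := Nat.cast_ne_zero.2 (Finset.card_pos.2 ⟨s, hsT⟩).ne'
      -- Averaging over `T`: `|T| y_s = ∑ (y_s - y_t) + ∑ y_t`. The first sum adds a new pair `(s,
      -- t)` to the product, while by `sum_memInd_mul` the second acts as a scalar. Since `s ∈ T`,
      -- the division by `|T|` is legitimate; the term `t = s` vanishes.
      have hmain : (fun J : Slice (2 * c) c => pairProd c r l J * ∏ s ∈ Q, memInd s J.1) =
          (T.card : ℂ)⁻¹ • ((∑ t ∈ T, fun J => (memInd s J.1 - memInd t J.1) *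
            (pairProd c r l J * ∏ q ∈ Q.erase s, memInd q J.1)) +
            ((c : ℂ) - p - (Q.erase s).card) •
              fun J => pairProd c r l J * ∏ q ∈ Q.erase s, memInd q J.1) := by
        funext J
        rw [Pi.smul_apply, Pi.add_apply, Finset.sum_apply, Pi.smul_apply, smul_eq_mul, smul_eq_mul,
          ← sum_memInd_mul h (Q.erase s) hr' hl' J T hT, ← Finset.sum_mul, ← add_mul,
          Finset.sum_sub_distrib, sub_add_cancel, Finset.sum_const, nsmul_eq_mul,
          ← Finset.mul_prod_erase Q _ hs]
        field_simp
      rw [hmain]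
      refine W.smul_mem _ (W.add_mem (W.sum_mem fun t ht => ?_) (W.smul_mem _ ?_))
      · rcases eq_or_ne s t with rfl | hst
        · convert W.zero_mem using 1
          funext J
          simp
        · obtain ⟨ht1, ht2⟩ := (hT t).1 ht
          have := ih (Q.erase s) (p + 1) (Fin.cons s r) (Fin.cons t l) hQ' (by omega)
            (h.cons hst hsr ht2) (fun i => ?_) (fun i => ?_)
          · simpa only [pairProd_cons, mul_assoc] using this
          · induction i using Fin.cases with
            | zero => simp
            | succ i => simpa using hr' i
          · induction i using Fin.cases with
            | zero => simpa using ht1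
            | succ i => simpa using hl' i
      · exact ih (Q.erase s) p r l hQ' (by omega) h hr' hl'
  rw [eq_top_iff, ← (Pi.basisFun ℂ (Slice (2 * c) c)).span_eq, Submodule.span_le]
  rintro _ ⟨J, rfl⟩
  -- With no pairs and `Q = J`, the function `∏ y_s` is the delta function at `J`: a `c`-element
  -- subset containing `J` equals `J`.
  have hJ := key c J.1 0 Fin.elim0 Fin.elim0 J.2 (by omega)
    ⟨fun i => i.elim0, fun i => i.elim0, fun i => i.elim0⟩ (fun i => i.elim0) (fun i => i.elim0)
  change Pi.basisFun ℂ (Slice (2 * c) c) J ∈ W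
  convert hJ using 1
  funext J'
  rw [Pi.basisFun_apply, Pi.single_apply]
  simp only [pairProd, Finset.univ_eq_empty, Finset.prod_empty, one_mul]
  split_ifs with h
  · subst h
    rw [Finset.prod_eq_one fun s hs => ?_]
    simp [memInd, hs]
  · by_contra hne
    refine h (Subtype.ext (Finset.eq_of_subset_of_card_le (fun s hs => ?_) ?_)).symm
    · by_contra hs'
      exact hne (Finset.prod_eq_zero hs (by simp [memInd, hs'])).symm
    · rw [J.2, J'.2]

/-- Any two sequences of disjoint pairs of the same length are related by a permutation. -/
lemma DisjointPairs.exists_perm {N p : ℕ} {r l r' l' : Fin p → Fin N} (h : DisjointPairs r l)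
    (h' : DisjointPairs r' l') : ∃ σ : Equiv.Perm (Fin N), σ ∘ r = r' ∧ σ ∘ l = l' := by
  have key {r l : Fin p → Fin N} (h : DisjointPairs r l) :
      Function.Injective (Sum.elim r l) := h.left.sumElim h.right h.ne
  let e := (Equiv.ofInjective _ (key h)).symm.trans (Equiv.ofInjective _ (key h'))
  have he (x) : (e ⟨Sum.elim r l x, x, rfl⟩ : Fin N) = Sum.elim r' l' x := by
    have : (⟨Sum.elim r l x, x, rfl⟩ : Set.range (Sum.elim r l)) = Equiv.ofInjective _ (key h) x :=
      rfl
    rw [this]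
    simp [e]
  classical
  refine ⟨e.extendSubtype, ?_, ?_⟩
  · funext i
    exact (e.extendSubtype_apply_of_mem (Sum.elim r l (Sum.inl i)) ⟨_, rfl⟩).trans (he (Sum.inl i))
  · funext i
    exact (e.extendSubtype_apply_of_mem (Sum.elim r l (Sum.inr i)) ⟨_, rfl⟩).trans (he (Sum.inr i))

/-! ### The Specht modules of two-column shapes -/

lemma cell_replicate_one (q k : ℕ) (hk : k < q) : cell (List.replicate q 1) k = (k, 0) := by
  induction q generalizing k with
  | zero => omega
  | succ q ih =>
    rw [List.replicate_succ, cell]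
    split_ifs with h
    · rw [Nat.lt_one_iff.1 h]
    · rw [ih (k - 1) (by omega)]
      simp only [Prod.mk.injEq, and_true]
      omega

lemma cell_twoOne (p q k : ℕ) (hk : k < 2 * p + q) :
    cell (List.replicate p 2 ++ List.replicate q 1) k =
      if k < 2 * p then (k / 2, k % 2) else (k - p, 0) := by
  induction p generalizing k with
  | zero =>
    rw [List.replicate_zero, List.nil_append, cell_replicate_one q k (by omega)]
    simp
  | succ p ih =>
    rw [List.replicate_succ, List.cons_append, cell]
    by_cases h : k < 2
    · rw [if_pos h, if_pos (by omega)]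
      ext <;> simp only <;> omega
    · rw [if_neg h, ih (k - 2) (by omega)]
      by_cases h2 : k < 2 * (p + 1)
      · rw [if_pos h2, if_pos (by omega)]
        ext <;> simp only <;> omega
      · rw [if_neg h2, if_neg (by omega)]
        ext <;> simp only
        omega

lemma sort_twoOne_parts {N p q : ℕ} (h : 2 * p + q = N) :
    (twoOne p q h).parts.sort (· ≥ ·) = List.replicate p 2 ++ List.replicate q 1 := by
  have h1 : (twoOne p q h).parts = ((List.replicate p 2 ++ List.replicate q 1 : List ℕ) :
      Multiset ℕ) := by
    rw [← Multiset.coe_add, Multiset.coe_replicate, Multiset.coe_replicate]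
    rfl
  rw [h1, Multiset.coe_sort]
  refine List.mergeSort_eq_self (r := (· ≥ ·)) ?_
  rw [List.pairwise_append]
  refine ⟨List.pairwise_replicate.2 (Or.inr le_rfl), List.pairwise_replicate.2 (Or.inr le_rfl), ?_⟩
  intro x hx y hy
  rw [List.eq_of_mem_replicate hx, List.eq_of_mem_replicate hy]
  norm_num

lemma tableauCell_twoOne {N p q : ℕ} (h : 2 * p + q = N) (i : Fin N) :
    tableauCell (twoOne p q h) i =
      if (i : ℕ) < 2 * p then ((i : ℕ) / 2, (i : ℕ) % 2) else ((i : ℕ) - p, 0) := by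
  rw [tableauCell, sort_twoOne_parts, cell_twoOne p q i (by omega)]

/-- The entry in the second column of a row of length two. -/
def secondEntry {N p q : ℕ} (h : 2 * p + q = N) (i : Fin p) : Fin N := ⟨2 * i + 1, by omega⟩

/-- The entry in the first column of a row of length two. -/
def firstEntry {N p q : ℕ} (h : 2 * p + q = N) (i : Fin p) : Fin N := ⟨2 * i, by omega⟩

section Specht

variable {N p q : ℕ} (h : 2 * p + q = N)

lemma disjointPairs_entries : DisjointPairs (secondEntry h) (firstEntry h) where
  left i j hij := by simp only [secondEntry, Fin.mk.injEq] at hij; omega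
  right i j hij := by simp only [firstEntry, Fin.mk.injEq] at hij; omega
  ne i j hij := by simp only [secondEntry, firstEntry, Fin.mk.injEq] at hij; omega

lemma column_eq_one_iff (k : Fin N) :
    (tableauCell (twoOne p q h) k).2 = 1 ↔ ∃ i, secondEntry h i = k := by
  rw [tableauCell_twoOne]
  constructor
  · intro hk
    split_ifs at hk with h1
    · exact ⟨⟨k / 2, by omega⟩, Fin.ext (by simp only [secondEntry]; simp only at hk; omega)⟩
  · rintro ⟨i, rfl⟩
    have : 2 * (i : ℕ) + 1 < 2 * p := by omega
    simp only [secondEntry, this, if_true]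
    rw [Nat.mul_add_mod]

lemma column_eq_iff (k k' : Fin N) :
    (tableauCell (twoOne p q h) k).2 = (tableauCell (twoOne p q h) k').2 ↔
      ((∃ i, secondEntry h i = k) ↔ ∃ i, secondEntry h i = k') := by
  rw [← column_eq_one_iff, ← column_eq_one_iff]
  have key (k : Fin N) : (tableauCell (twoOne p q h) k).2 = 0 ∨
      (tableauCell (twoOne p q h) k).2 = 1 := by
    rw [tableauCell_twoOne]
    split_ifs
    · simp only; omega
    · simp
  rcases key k with h1 | h1 <;> rcases key k' with h2 | h2 <;> simp [h1, h2]

lemma row_swap (i : Fin p) (k : Fin N) :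
    (tableauCell (twoOne p q h) (Equiv.swap (secondEntry h i) (firstEntry h i) k)).1 =
      (tableauCell (twoOne p q h) k).1 := by
  have key : (tableauCell (twoOne p q h) (secondEntry h i)).1 =
      (tableauCell (twoOne p q h) (firstEntry h i)).1 := by
    rw [tableauCell_twoOne, tableauCell_twoOne, if_pos, if_pos]
    · simp only [secondEntry, firstEntry]; omega
    · simp only [firstEntry]; omega
    · simp only [secondEntry]; omega
  rcases eq_or_ne k (secondEntry h i) with rfl | h1
  · rw [Equiv.swap_apply_left, key]
  rcases eq_or_ne k (firstEntry h i) with rfl | h2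
  · rw [Equiv.swap_apply_right, key]
  rw [Equiv.swap_apply_of_ne_of_ne h1 h2]

lemma row_eq (k k' : Fin N)
    (hk : (tableauCell (twoOne p q h) k).1 = (tableauCell (twoOne p q h) k').1) :
    k = k' ∨ ∃ i, (k = secondEntry h i ∧ k' = firstEntry h i) ∨
      (k' = secondEntry h i ∧ k = firstEntry h i) := by
  rw [tableauCell_twoOne, tableauCell_twoOne] at hk
  rcases eq_or_ne k k' with h0 | h0
  · exact Or.inl h0
  right
  have h0' : (k : ℕ) ≠ k' := fun e => h0 (Fin.ext e)
  split_ifs at hk with h1 h2 h2 <;> simp only at hk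
  · refine ⟨⟨k / 2, by omega⟩, ?_⟩
    simp only [secondEntry, firstEntry, Fin.ext_iff]
    omega
  all_goals omega

/-- Rows have at most two cells, so a row-preserving permutation can only exchange entries within
rows of length two, and every such exchange sends a second entry to a first one. -/
lemma row_preserving_eq_one (g : Equiv.Perm (Fin N))
    (hg : ∀ i, (tableauCell (twoOne p q h) (g i)).1 = (tableauCell (twoOne p q h) i).1)
    (hr : ∀ i, g (secondEntry h i) ≠ firstEntry h i) : g = 1 := by
  have hd := disjointPairs_entries h
  have hfix (i) : g (secondEntry h i) = secondEntry h i := by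
    rcases row_eq h _ _ (hg (secondEntry h i)) with h1 | ⟨j, ⟨h1, h2⟩ | ⟨h1, h2⟩⟩
    · exact h1
    · exact absurd h2 (hd.ne i j)
    · obtain rfl := hd.left h1
      exact absurd h2 (hr i)
  ext1 k
  rcases row_eq h _ _ (hg k) with h1 | ⟨j, ⟨h1, h2⟩ | ⟨h1, h2⟩⟩
  · exact h1
  · have := g.injective (h1.trans (hfix j).symm)
    exact absurd (this.symm.trans h2) (hd.ne j j)
  · rw [h1] at h2
    exact absurd h2 (hr j)

/-! ### The Young symmetrizer acting on functions on subsets -/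

open Classical in
/-- The sum of the permutations preserving the rows. -/
def rowSum {n : ℕ} (lam : n.Partition) : MonoidAlgebra ℂ (Equiv.Perm (Fin n)) :=
  ∑ g : Equiv.Perm (Fin n) with ∀ i, (tableauCell lam (g i)).1 = (tableauCell lam i).1,
      MonoidAlgebra.single g 1

open Classical in
/-- The signed sum of the permutations preserving the columns. -/
def colSum {n : ℕ} (lam : n.Partition) : MonoidAlgebra ℂ (Equiv.Perm (Fin n)) :=
  ∑ g : Equiv.Perm (Fin n) with ∀ i, (tableauCell lam (g i)).2 = (tableauCell lam i).2,
      MonoidAlgebra.single g ((Equiv.Perm.sign g : ℤ) : ℂ)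

lemma youngSymmetrizer_eq {n : ℕ} (lam : n.Partition) :
    youngSymmetrizer lam = rowSum lam * colSum lam := rfl

open Classical in
/-- The indicator function of the subsets containing the second column. -/
def columnInd (c : ℕ) : Slice N c → ℂ := fun J => if ∀ i, secondEntry h i ∈ J.1 then 1 else 0

open Classical in
lemma columnInd_move_inv (c : ℕ) (g : Equiv.Perm (Fin N)) (J : Slice N c) :
    columnInd h c (J.move g⁻¹) = if ∀ i, g (secondEntry h i) ∈ J.1 then 1 else 0 := by
  simp only [columnInd, Slice.mem_move, inv_inv]

/-- A column-preserving permutation maps the second column to itself, so it fixes the indicator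
function up to sign, and the sign twist cancels the sign in the sum. The factor is the order of the
column group. -/
lemma exists_colSum_columnInd (c : ℕ) : ∃ K : ℂ, K ≠ 0 ∧
    (sliceRep N c).asAlgebraHom (colSum (twoOne p q h)) (columnInd h c) = K • columnInd h c := by
  classical
  refine ⟨((Finset.univ.filter fun g : Equiv.Perm (Fin N) =>
    ∀ i, (tableauCell (twoOne p q h) (g i)).2 = (tableauCell (twoOne p q h) i).2).card : ℂ),
    ?_, ?_⟩
  · rw [Nat.cast_ne_zero, ← Nat.pos_iff_ne_zero, Finset.card_pos]
    exact ⟨1, by simp⟩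
  · rw [colSum, map_sum, LinearMap.sum_apply, Nat.cast_smul_eq_nsmul ℂ,
      ← Finset.sum_const]
    refine Finset.sum_congr (by congr) fun g hg => ?_
    rw [Finset.mem_filter] at hg
    have hg := hg.2
    rw [Representation.asAlgebraHom_single, LinearMap.smul_apply]
    funext J
    rw [Pi.smul_apply, sliceRep_apply, columnInd_move_inv, smul_eq_mul, ← mul_assoc,
      csign_mul_self, one_mul, columnInd]
    have h1 : (∀ i, g (secondEntry h i) ∈ J.1) ↔ ∀ i, secondEntry h i ∈ J.1 := by
      constructor
      · intro hJ i
        have h2 := (column_eq_iff h _ _).1 (hg (g⁻¹ (secondEntry h i)))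
        obtain ⟨j, hj⟩ := h2.1 ⟨i, by simp⟩
        have := hJ j
        rw [hj] at this
        simpa using this
      · intro hJ i
        have h2 := (column_eq_iff h _ _).1 (hg (secondEntry h i))
        obtain ⟨j, hj⟩ := h2.2 ⟨i, rfl⟩
        rw [← hj]
        exact hJ j
    simp only [h1]

lemma single_swap_mul_rowSum (i : Fin p) :
    MonoidAlgebra.single (Equiv.swap (secondEntry h i) (firstEntry h i)) 1 *
      rowSum (twoOne p q h) = rowSum (twoOne p q h) := by
  classical
  rw [rowSum, Finset.mul_sum]
  refine Finset.sum_nbij' (fun g => Equiv.swap (secondEntry h i) (firstEntry h i) * g)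
    (fun g => Equiv.swap (secondEntry h i) (firstEntry h i) * g) ?_ ?_ ?_ ?_ ?_
  · intro g hg
    simp only [Finset.mem_filter, Finset.mem_univ, true_and] at hg ⊢
    intro k
    rw [Equiv.Perm.mul_apply, row_swap, hg]
  · intro g hg
    simp only [Finset.mem_filter, Finset.mem_univ, true_and] at hg ⊢
    intro k
    rw [Equiv.Perm.mul_apply, row_swap, hg]
  · intro g _
    simp
  · intro g _
    simp
  · intro g _
    rw [MonoidAlgebra.single_mul_single, mul_one]

/-- Both sides are invariant under the row transpositions, so they may be compared on subsets
containing the second entries and none of the first entries of the rows of length two. There only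
the identity contributes to the row sum. -/
lemma rowSum_columnInd (c : ℕ) :
    (sliceRep N c).asAlgebraHom (rowSum (twoOne p q h)) (columnInd h c) =
      pairProd c (secondEntry h) (firstEntry h) := by
  classical
  have hd := disjointPairs_entries h
  rw [← sub_eq_zero]
  refine eq_zero_of_swap_invariant hd _ (fun i => ?_) fun J hJ => ?_
  · rw [map_sub, sliceRep_swap_pairProd hd]
    congr 1
    have : sliceRep N c (Equiv.swap (secondEntry h i) (firstEntry h i)) =
        (sliceRep N c).asAlgebraHom
          (MonoidAlgebra.single (Equiv.swap (secondEntry h i) (firstEntry h i)) 1) := by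
      rw [Representation.asAlgebraHom_single, one_smul]
    rw [this, ← Module.End.mul_apply, ← map_mul, single_swap_mul_rowSum]
  · rw [Pi.sub_apply, pairProd_eq_one J hJ, sub_eq_zero, rowSum, map_sum, LinearMap.sum_apply,
      Finset.sum_apply, Finset.sum_eq_single 1]
    · rw [Representation.asAlgebraHom_single, one_smul, map_one, Module.End.one_apply, columnInd,
        if_pos fun i => (hJ i).1]
    · intro g hg hg1
      rw [Representation.asAlgebraHom_single, one_smul, sliceRep_apply, columnInd_move_inv,
        if_neg, mul_zero]
      intro hall
      refine hg1 (row_preserving_eq_one h g (Finset.mem_filter.1 hg).2 fun i hi => ?_)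
      exact (hJ i).2 (hi ▸ hall i)
    · intro h1
      exact absurd (Finset.mem_filter.2 ⟨Finset.mem_univ _, fun _ => rfl⟩) h1

/-- For subsets of size `p`, the indicator function is the delta function at the second column,
whose stabilizer is the column group. So the function obtained from it by `w` determines `w *
colSum`, which is how injectivity on the Specht module is detected. -/
lemma coeff_mul_colSum (w : MonoidAlgebra ℂ (Equiv.Perm (Fin N))) (τ : Equiv.Perm (Fin N)) :
    (w * colSum (twoOne p q h)).coeff τ = csign τ * (sliceRep N p).asAlgebraHom w (columnInd h p)
      ((rangeSlice (secondEntry h) (disjointPairs_entries h).left).move τ) := by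
  classical
  set S := rangeSlice (secondEntry h) (disjointPairs_entries h).left
  induction w using MonoidAlgebra.induction_on with
  | add x y hx hy => simp only [add_mul, MonoidAlgebra.coeff_add, Finsupp.add_apply, hx, hy,
      map_add, LinearMap.add_apply, Pi.add_apply, mul_add]
  | smul u x hx => simp only [smul_mul_assoc, MonoidAlgebra.coeff_smul, Finsupp.smul_apply, hx,
      map_smul, LinearMap.smul_apply, Pi.smul_apply, smul_eq_mul, mul_left_comm]
  | of g =>
    rw [MonoidAlgebra.of_apply, MonoidAlgebra.coeff_single_mul_apply, one_mul,
      Representation.asAlgebraHom_single, one_smul, sliceRep_apply, ← Slice.move_mul, ← mul_assoc]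
    have hsign : csign τ * csign g = csign (g⁻¹ * τ) := by
      rw [csign_mul, mul_comm]
      simp [csign]
    rw [hsign]
    generalize g⁻¹ * τ = u
    have hcol : (∀ i, (tableauCell (twoOne p q h) (u i)).2 = (tableauCell (twoOne p q h) i).2) ↔
        ∀ i, secondEntry h i ∈ (S.move u).1 := by
      simp only [column_eq_iff]
      constructor
      · intro hu i
        rw [Slice.mem_move, mem_rangeSlice, ← hu]
        exact ⟨i, by simp⟩
      · intro hu k
        have h1 := eq_rangeSlice (disjointPairs_entries h).left hu
        rw [← mem_rangeSlice _ (disjointPairs_entries h).left,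
          ← mem_rangeSlice _ (disjointPairs_entries h).left, ← h1, Slice.mem_move,
          Equiv.Perm.inv_def, Equiv.symm_apply_apply, h1]
    have hcoeff : (colSum (twoOne p q h)).coeff u =
        if ∀ i, (tableauCell (twoOne p q h) (u i)).2 = (tableauCell (twoOne p q h) i).2
          then csign u else 0 := by
      rw [colSum, MonoidAlgebra.coeff_sum, Finsupp.finsetSum_apply]
      simp only [MonoidAlgebra.coeff_single, Finsupp.single_apply]
      rw [Finset.sum_ite_eq']
      simp
    rw [hcoeff, columnInd]
    simp only [hcol, mul_ite, mul_one, mul_zero]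

/-! ### Maps from two-column Specht modules to functions on subsets -/

/-- The map from the Specht module of a two-column shape to the functions on the `c`-element
subsets. -/
def spechtMap (c : ℕ) : SpechtModule (twoOne p q h) →ₗ[ℂ] (Slice N c → ℂ) where
  toFun x := (sliceRep N c).asAlgebraHom (x : spechtIdeal (twoOne p q h)).1 (columnInd h c)
  map_add' x y := by
    change (sliceRep N c).asAlgebraHom ((x : spechtIdeal (twoOne p q h)).1 +
      (y : spechtIdeal (twoOne p q h)).1) _ = _
    rw [map_add, LinearMap.add_apply]
  map_smul' u x := by
    change (sliceRep N c).asAlgebraHom (u • (x : spechtIdeal (twoOne p q h)).1) _ = _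
    rw [map_smul, LinearMap.smul_apply]
    rfl

lemma spechtMap_specht (c : ℕ) (g : Equiv.Perm (Fin N)) (x : SpechtModule (twoOne p q h)) :
    spechtMap h c (specht _ g x) = sliceRep N c g (spechtMap h c x) := by
  change (sliceRep N c).asAlgebraHom (MonoidAlgebra.single g 1 *
    (x : spechtIdeal (twoOne p q h)).1) _ = _
  rw [map_mul, Module.End.mul_apply, Representation.asAlgebraHom_single, one_smul]
  rfl

/-- The element `w * c` of the Specht module, where `c` is the Young symmetrizer. -/
def spechtMk {n : ℕ} (lam : n.Partition) (w : MonoidAlgebra ℂ (Equiv.Perm (Fin n))) :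
    SpechtModule lam :=
  (⟨w * youngSymmetrizer lam, Ideal.mul_mem_left _ _ (Ideal.subset_span rfl)⟩ : spechtIdeal lam)

lemma exists_spechtMk {n : ℕ} {lam : n.Partition} (x : SpechtModule lam) :
    ∃ w, x = spechtMk lam w := by
  obtain ⟨w, hw⟩ := Submodule.mem_span_singleton.1 (x : spechtIdeal lam).2
  exact ⟨w, Subtype.ext hw.symm⟩

lemma exists_spechtMap_spechtMk (c : ℕ) : ∃ K : ℂ, K ≠ 0 ∧ ∀ w,
    spechtMap h c (spechtMk _ w) =
      K • (sliceRep N c).asAlgebraHom w (pairProd c (secondEntry h) (firstEntry h)) := by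
  obtain ⟨K, hK, hcol⟩ := exists_colSum_columnInd h c
  refine ⟨K, hK, fun w => ?_⟩
  change (sliceRep N c).asAlgebraHom (w * youngSymmetrizer _) _ = _
  rw [youngSymmetrizer_eq, map_mul, map_mul, Module.End.mul_apply, Module.End.mul_apply, hcol,
    map_smul, map_smul, rowSum_columnInd]

lemma sliceSum_spechtMap_of_lt {c p' : ℕ} (hp : p' < p) (x : SpechtModule (twoOne p q h)) :
    sliceSum N c p' (spechtMap h c x) = 0 := by
  obtain ⟨K, -, hK⟩ := exists_spechtMap_spechtMk h c
  obtain ⟨w, rfl⟩ := exists_spechtMk x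
  rw [hK, map_smul, sliceSum_asAlgebraHom, sliceSum_pairProd_of_lt (disjointPairs_entries h) hp,
    map_zero, smul_zero]

/-- Summation to size `p` turns the image of `w * rowSum * colSum` into a nonzero multiple of `w *
rowSum` applied to the delta function at the second column. If that vanishes, so do all coefficients
of the element, by `coeff_mul_colSum`. -/
lemma eq_zero_of_sliceSum_spechtMap {c : ℕ} (hp : p ≤ c) (hc : c + p ≤ N)
    (x : SpechtModule (twoOne p q h)) (hx : sliceSum N c p (spechtMap h c x) = 0) : x = 0 := by
  obtain ⟨K, hK0, hK⟩ := exists_spechtMap_spechtMk h c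
  obtain ⟨K', hK'0, hK'⟩ := exists_sliceSum_pairProd (disjointPairs_entries h) hp hc
  obtain ⟨w, rfl⟩ := exists_spechtMk x
  rw [hK, map_smul, sliceSum_asAlgebraHom, hK', map_smul, smul_smul,
    smul_eq_zero_iff_right (mul_ne_zero hK0 hK'0), ← rowSum_columnInd, ← Module.End.mul_apply,
    ← map_mul] at hx
  refine Subtype.ext (MonoidAlgebra.ext (Finsupp.ext fun τ => ?_))
  change (w * youngSymmetrizer _).coeff τ = 0
  rw [youngSymmetrizer_eq, ← mul_assoc, coeff_mul_colSum, hx, Pi.zero_apply, mul_zero]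

/-- The Young symmetrizer itself gives the product for the rows of the tableau, and a permutation
carries it to any other family of `p` disjoint pairs. -/
lemma pairProd_mem_range_spechtMap (c : ℕ) {r l : Fin p → Fin N} (hd : DisjointPairs r l) :
    pairProd c r l ∈ LinearMap.range (spechtMap h c) := by
  obtain ⟨K, hK0, hK⟩ := exists_spechtMap_spechtMk h c
  obtain ⟨σ, rfl, rfl⟩ := (disjointPairs_entries h).exists_perm hd
  refine ⟨spechtMk _ ((K⁻¹ * csign σ) • MonoidAlgebra.single σ 1), ?_⟩
  rw [hK, map_smul, Representation.asAlgebraHom_single, one_smul, LinearMap.smul_apply,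
    sliceRep_pairProd, smul_smul, smul_smul, mul_assoc, mul_assoc, csign_mul_self, mul_one,
    mul_inv_cancel₀ hK0, one_smul]

end Specht

/-! ### Decomposition of the functions on the half-size subsets -/

/-- The complement of a half-size subset. -/
def Slice.compl {c : ℕ} (J : Slice (2 * c) c) : Slice (2 * c) c :=
  ⟨J.1ᶜ, by rw [Finset.card_compl, J.2, Fintype.card_fin]; omega⟩

/-- Pull back along taking complements. -/
def complMap (c : ℕ) : (Slice (2 * c) c → ℂ) →ₗ[ℂ] (Slice (2 * c) c → ℂ) :=
  LinearMap.funLeft ℂ ℂ Slice.compl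

lemma complMap_apply {c : ℕ} (f : Slice (2 * c) c → ℂ) (J : Slice (2 * c) c) :
    complMap c f J = f J.compl := rfl

lemma complMap_sliceRep {c : ℕ} (σ : Equiv.Perm (Fin (2 * c))) (f : Slice (2 * c) c → ℂ) :
    complMap c (sliceRep _ c σ f) = sliceRep _ c σ (complMap c f) := by
  funext J
  rw [complMap_apply, sliceRep_apply, sliceRep_apply, complMap_apply]
  congr 2
  exact Slice.ext_mem fun i => by simp [Slice.mem_move, Slice.compl]

lemma complMap_asAlgebraHom {c : ℕ} (x : MonoidAlgebra ℂ (Equiv.Perm (Fin (2 * c))))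
    (f : Slice (2 * c) c → ℂ) :
    complMap c ((sliceRep _ c).asAlgebraHom x f) = (sliceRep _ c).asAlgebraHom x (complMap c f) := by
  induction x using MonoidAlgebra.induction_on with
  | of σ => simp [Representation.asAlgebraHom_single, complMap_sliceRep, MonoidAlgebra.of_apply]
  | add x y hx hy => simp [hx, hy]
  | smul u x hx => simp [hx]

/-- Complementation sends `y_s` to `1 - y_s`, which negates each of the `p` differences. -/
lemma complMap_pairProd {c p : ℕ} (r l : Fin p → Fin (2 * c)) :
    complMap c (pairProd c r l) = (-1 : ℂ) ^ p • pairProd c r l := by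
  funext J
  have key (s) : memInd s J.compl.1 = 1 - memInd s J.1 := by
    by_cases hs : s ∈ J.1 <;> simp [memInd, Slice.compl, hs]
  rw [complMap_apply, pairProd, Pi.smul_apply, pairProd, smul_eq_mul,
    show (-1 : ℂ) ^ p = ∏ _i : Fin p, (-1 : ℂ) by simp, ← Finset.prod_mul_distrib]
  refine Finset.prod_congr rfl fun i _ => ?_
  rw [key, key]
  ring

lemma complMap_spechtMap {c p q : ℕ} (h : 2 * p + q = 2 * c) (x : SpechtModule (twoOne p q h)) :
    complMap c (spechtMap h c x) = (-1 : ℂ) ^ p • spechtMap h c x := by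
  obtain ⟨K, -, hK⟩ := exists_spechtMap_spechtMk h c
  obtain ⟨w, rfl⟩ := exists_spechtMk x
  rw [hK, map_smul, complMap_asAlgebraHom, complMap_pairProd, map_smul, smul_comm]

/-- The sum of the maps from the Specht modules `[2^{c-j}, 1^{2j}]` to the functions on the
half-size subsets. -/
def spechtSumMap (c : ℕ) (h : ∀ j : Fin (c + 1), 2 * (c - (j : ℕ)) + 2 * j = 2 * c) :
    (⨁ j : Fin (c + 1), SpechtModule (twoOne (c - (j : ℕ)) (2 * j) (h j))) →ₗ[ℂ]
      (Slice (2 * c) c → ℂ) :=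
  DirectSum.toModule ℂ _ _ fun j => spechtMap (h j) c

lemma spechtSumMap_eq_sum (c : ℕ) (h : ∀ j : Fin (c + 1), 2 * (c - (j : ℕ)) + 2 * j = 2 * c)
    (x : ⨁ j : Fin (c + 1), SpechtModule (twoOne (c - (j : ℕ)) (2 * j) (h j))) :
    spechtSumMap c h x = ∑ j, spechtMap (h j) c (x j) := by
  classical
  induction x using DirectSum.induction_on with
  | zero => simp
  | add x y hx hy => simp [hx, hy, Finset.sum_add_distrib]
  | of i x =>
    rw [Finset.sum_eq_single i]
    · rw [DirectSum.of_eq_same]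
      exact DirectSum.toModule_lof ℂ (φ := fun j => spechtMap (h j) c) i x
    · intro j _ hj
      rw [DirectSum.of_eq_of_ne _ _ _ hj, map_zero]
    · simp

theorem spechtSumMap_injective (c : ℕ)
    (h : ∀ j : Fin (c + 1), 2 * (c - (j : ℕ)) + 2 * j = 2 * c) :
    Function.Injective (spechtSumMap c h) := by
  rw [injective_iff_map_eq_zero]
  intro x hx
  rw [spechtSumMap_eq_sum] at hx
  -- Triangularity, by induction on the length `p = c - j` of the second column: summing to size `p`
  -- kills the modules with a longer second column, those with a shorter one vanish by induction,
  -- and one term remains.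
  suffices ∀ k, ∀ j : Fin (c + 1), c - (j : ℕ) = k → x j = 0 from
    DFinsupp.ext fun j => this _ j rfl
  intro k
  induction k using Nat.strong_induction_on with
  | _ k ih =>
  intro j hj
  refine eq_zero_of_sliceSum_spechtMap (h j) (c := c) (by omega) (by omega) (x j) ?_
  have h1 := congrArg (sliceSum (2 * c) c (c - (j : ℕ))) hx
  rw [map_sum, map_zero, Finset.sum_eq_single j] at h1
  · exact h1
  · intro i _ hij
    have hij' : (i : ℕ) ≠ j := fun e => hij (Fin.ext e)
    rcases lt_or_gt_of_ne hij' with hlt | hgt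
    · exact sliceSum_spechtMap_of_lt (h i) (by omega) _
    · rw [ih (c - (i : ℕ)) (by omega) i rfl, map_zero, map_zero]
  · simp

theorem spechtSumMap_surjective (c : ℕ)
    (h : ∀ j : Fin (c + 1), 2 * (c - (j : ℕ)) + 2 * j = 2 * c) :
    Function.Surjective (spechtSumMap c h) := by
  classical
  rw [← LinearMap.range_eq_top, eq_top_iff, ← span_pairProd, Submodule.span_le]
  rintro _ ⟨p, r, l, hp, hd, rfl⟩
  obtain ⟨j, rfl⟩ : ∃ j : Fin (c + 1), p = c - (j : ℕ) :=
    ⟨⟨c - p, by omega⟩, by simp only; omega⟩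
  obtain ⟨x, hx⟩ := pairProd_mem_range_spechtMap (h j) c hd
  refine ⟨DirectSum.lof ℂ _ _ j x, ?_⟩
  rw [spechtSumMap, DirectSum.toModule_lof, hx]

/-! ### One-dimensional Specht modules -/

/-- The Specht module `[m]` is the trivial representation. -/
theorem exists_specht_row (m : ℕ) : ∃ e : SpechtModule (row m) ≃ₗ[ℂ] ℂ,
    ∀ g x, e (specht (row m) g x) = e x := by
  classical
  have hcell (i : Fin m) : tableauCell (row m) i = (0, (i : ℕ)) := by
    have hm : m ≠ 0 := by have := i.2; omega
    rw [tableauCell, Nat.Partition.indiscrete_parts hm, Multiset.sort_singleton, cell, if_pos i.2]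
  set s : MonoidAlgebra ℂ (Equiv.Perm (Fin m)) := ∑ g, MonoidAlgebra.single g 1
  have hrow : rowSum (row m) = s := by
    rw [rowSum, Finset.filter_true_of_mem fun g _ i => by rw [hcell, hcell]]
  have hcol : colSum (row m) = 1 := by
    rw [colSum, Finset.sum_eq_single (1 : Equiv.Perm (Fin m))]
    · simp [MonoidAlgebra.one_def]
    · intro g hg hg1
      refine absurd (Equiv.ext fun i => Fin.ext ?_) hg1
      have := (Finset.mem_filter.1 hg).2 i
      rwa [hcell, hcell] at this
    · simp
  have hsym : youngSymmetrizer (row m) = s := by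
    rw [youngSymmetrizer_eq, hrow, hcol, mul_one]
  -- For one row the symmetrizer is the sum of all permutations. It absorbs left multiplication, so
  -- the ideal is the line spanned by it, and the coefficient at the identity is a coordinate.
  have hs (g) : MonoidAlgebra.single g 1 * s = s := by
    rw [Finset.mul_sum]
    refine Fintype.sum_equiv (Equiv.mulLeft g) _ _ fun k => ?_
    rw [MonoidAlgebra.single_mul_single, mul_one, Equiv.coe_mulLeft]
  have hw (w : MonoidAlgebra ℂ (Equiv.Perm (Fin m))) : ∃ u : ℂ, w * s = u • s := by
    induction w using MonoidAlgebra.induction_on with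
    | of g => exact ⟨1, by rw [MonoidAlgebra.of_apply, hs, one_smul]⟩
    | add x y hx hy =>
      obtain ⟨u, hu⟩ := hx
      obtain ⟨v, hv⟩ := hy
      exact ⟨u + v, by rw [add_mul, hu, hv, add_smul]⟩
    | smul v x hx =>
      obtain ⟨u, hu⟩ := hx
      exact ⟨v * u, by rw [smul_mul_assoc, hu, smul_smul]⟩
  have hs1 : s.coeff 1 = 1 := by
    rw [MonoidAlgebra.coeff_sum, Finsupp.finsetSum_apply]
    simp only [MonoidAlgebra.coeff_single, Finsupp.single_apply]
    rw [Finset.sum_ite_eq']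
    simp
  have hmem (x : SpechtModule (row m)) : ∃ u : ℂ, (x : spechtIdeal (row m)).1 = u • s := by
    obtain ⟨w, rfl⟩ := exists_spechtMk x
    obtain ⟨u, hu⟩ := hw w
    exact ⟨u, by rw [← hu, ← hsym]; rfl⟩
  let f : SpechtModule (row m) →ₗ[ℂ] ℂ :=
    { toFun := fun x => (x : spechtIdeal (row m)).1.coeff 1
      map_add' := fun _ _ => rfl
      map_smul' := fun _ _ => rfl }
  refine ⟨LinearEquiv.ofBijective f ⟨?_, ?_⟩, fun g x => ?_⟩
  · rw [injective_iff_map_eq_zero]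
    intro x hx
    obtain ⟨u, hu⟩ := hmem x
    have h1 : f x = u := by
      change (x : spechtIdeal (row m)).1.coeff 1 = u
      rw [hu, MonoidAlgebra.coeff_smul, Finsupp.smul_apply, hs1, smul_eq_mul, mul_one]
    rw [h1] at hx
    exact Subtype.ext (hu.trans (by rw [hx, zero_smul]; rfl))
  · intro u
    refine ⟨u • spechtMk _ 1, ?_⟩
    rw [map_smul]
    change u • (1 * youngSymmetrizer (row m)).coeff 1 = u
    rw [one_mul, hsym, hs1, smul_eq_mul, mul_one]
  · obtain ⟨u, hu⟩ := hmem x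
    change (MonoidAlgebra.single g 1 * (x : spechtIdeal (row m)).1).coeff 1 =
      (x : spechtIdeal (row m)).1.coeff 1
    rw [hu, mul_smul_comm, hs]

/-- The Specht module `[1^m]` is the sign representation. -/
theorem exists_specht_col (m : ℕ) : ∃ e : SpechtModule (col m) ≃ₗ[ℂ] ℂ,
    ∀ g x, e (specht (col m) g x) = csign g * e x := by
  have h : 2 * 0 + m = m := by omega
  let S : Slice m 0 := ⟨∅, rfl⟩
  have hS (J : Slice m 0) : J = S := Subtype.ext (Finset.card_eq_zero.1 J.2)
  -- Here `p = c = 0`: the only subset is empty, so the target is a line on which the twisted action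
  -- is the sign.
  let f : SpechtModule (col m) →ₗ[ℂ] ℂ := LinearMap.proj S ∘ₗ spechtMap h 0
  refine ⟨LinearEquiv.ofBijective f ⟨?_, ?_⟩, fun g x => ?_⟩
  · rw [injective_iff_map_eq_zero]
    intro x hx
    refine eq_zero_of_sliceSum_spechtMap h (c := 0) le_rfl (by omega) x ?_
    have : spechtMap h 0 x = 0 := funext fun J => by rw [hS J]; exact hx
    rw [this, map_zero]
  · intro u
    obtain ⟨x, hx⟩ := pairProd_mem_range_spechtMap h 0 (disjointPairs_entries h)
    refine ⟨u • x, ?_⟩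
    rw [map_smul]
    change u • spechtMap h 0 x S = u
    rw [hx]
    simp [pairProd]
  · change spechtMap h 0 (specht _ g x) S = csign g * spechtMap h 0 x S
    rw [spechtMap_specht, sliceRep_apply, hS (Slice.move _ _)]

/-- The tensor powers of the sign representation of `𝔖_2`. -/
theorem exists_tensorPower_specht_col (k : ℕ) :
    ∃ e : (⨂[ℂ] _ : Fin k, SpechtModule (col 2)) ≃ₗ[ℂ] ℂ,
      ∀ g x, e (tensorPower (specht (col 2)) k g x) = csign g ^ k * e x := by
  obtain ⟨e, he⟩ := exists_specht_col 2
  let E : (⨂[ℂ] _ : Fin k, SpechtModule (col 2)) ≃ₗ[ℂ] ℂ :=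
    (PiTensorProduct.congr fun _ => e).trans
      (PiTensorProduct.constantBaseRingEquiv (Fin k) ℂ).toLinearEquiv
  have hE (v : Fin k → SpechtModule (col 2)) : E (PiTensorProduct.tprod ℂ v) = ∏ i, e (v i) := by
    simp [E]
  refine ⟨E, fun g x => ?_⟩
  suffices E.toLinearMap ∘ₗ tensorPower (specht (col 2)) k g = (csign g ^ k) • E.toLinearMap from
    LinearMap.congr_fun this x
  refine PiTensorProduct.ext (MultilinearMap.ext fun v => ?_)
  change E (PiTensorProduct.map (fun _ => specht (col 2) g) (PiTensorProduct.tprod ℂ v)) =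
    csign g ^ k * E (PiTensorProduct.tprod ℂ v)
  rw [PiTensorProduct.map_tprod, hE, hE]
  simp only [he, Finset.prod_mul_distrib, Finset.prod_const, Finset.card_univ, Fintype.card_fin]

/-! ### Young subgroups as stabilizers -/

lemma exists_young₂_eq {p q m : ℕ} (h : p + q = m) (u : Equiv.Perm (Fin m))
    (hu : ∀ i : Fin m, (i : ℕ) < p → (u i : ℕ) < p) : ∃ x, young₂ h x = u := by
  let e := (finSumFinEquiv (m := p) (n := q)).trans (finCongr h)
  have hmaps : Set.MapsTo (e.symm.permCongr u) (Set.range Sum.inl) (Set.range Sum.inl) := by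
    rintro _ ⟨i, rfl⟩
    have hlt : (u (e (Sum.inl i)) : ℕ) < p := hu _ (by simp [e])
    refine ⟨⟨u (e (Sum.inl i)), hlt⟩, ?_⟩
    rw [Equiv.permCongr_apply, Equiv.symm_symm, Equiv.eq_symm_apply]
    exact Fin.ext (by simp [e])
  obtain ⟨x, hx⟩ := Equiv.Perm.mem_sumCongrHom_range_of_perm_mapsTo_inl hmaps
  refine ⟨x, ?_⟩
  change e.permCongr (Equiv.Perm.sumCongrHom _ _ x) = u
  rw [hx]
  ext i
  simp

/-- The degrees `2, 1, 0` are distinct, so a permutation stabilizing them preserves each of the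
three blocks. The first block is split off, then the second. -/
lemma exists_young₃_eq {p q r n : ℕ} (h : p + (q + r) = n) (u : Equiv.Perm (Fin n))
    (hu : ∀ i, blockDeg n p q 2 1 0 (u i) = blockDeg n p q 2 1 0 i) : ∃ x, young₃ h x = u := by
  have key (i : Fin n) : ((u i : ℕ) < p ↔ (i : ℕ) < p) ∧ ((u i : ℕ) < p + q ↔ (i : ℕ) < p + q) := by
    have := hu i
    unfold blockDeg at this
    split_ifs at this <;> omega
  obtain ⟨⟨σ, v⟩, rfl⟩ := exists_young₂_eq h u fun i hi => (key i).1.2 hi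
  obtain ⟨x, hx⟩ := exists_young₂_eq (rfl : q + r = q + r) v fun i hi => by
    have h1 := (key (finCongr h (Fin.natAdd p i))).2.2 (by simpa using hi)
    rw [young₂_ge] at h1
    simpa using h1
  exact ⟨(σ, x), by rw [← hx]; rfl⟩

lemma csign_young₂ {p q m : ℕ} (h : p + q = m)
    (x : Equiv.Perm (Fin p) × Equiv.Perm (Fin q)) :
    csign (young₂ h x) = csign x.1 * csign x.2 := by
  have : Equiv.Perm.sign (young₂ h x) = Equiv.Perm.sign x.1 * Equiv.Perm.sign x.2 := by
    change Equiv.Perm.sign (((finSumFinEquiv (m := p) (n := q)).trans (finCongr h)).permCongr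
      (Equiv.sumCongr x.1 x.2)) = _
    rw [Equiv.Perm.sign_permCongr, Equiv.Perm.sign_sumCongr]
  simp [csign, this]

/-! ### The representation induced from the sign representation of a Young subgroup -/

lemma exists_move_eq {N c : ℕ} (J J' : Slice N c) : ∃ σ, J.move σ = J' := by
  classical
  let e : {x // x ∈ J.1} ≃ {x // x ∈ J'.1} :=
    Fintype.equivOfCardEq (by rw [Fintype.card_coe, Fintype.card_coe, J.2, J'.2])
  refine ⟨e.extendSubtype, ?_⟩
  refine Subtype.ext (Finset.eq_of_subset_of_card_le (fun k hk => ?_) ?_)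
  · rw [Slice.move, Finset.mem_map_equiv] at hk
    have := e.extendSubtype_mem _ hk
    rwa [Equiv.apply_symm_apply] at this
  · rw [J'.2, (J.move _).2]

lemma iSup_range_indMk_one {G H M : Type*} [Group G] [Group H] [AddCommGroup M]
    [Module ℂ M] (φ : G →* H) (ρ : Representation ℂ G M) :
    ⨆ k, (LinearMap.range (indMk φ ρ 1)).map (ind φ ρ k) = ⊤ := by
  rw [eq_top_iff, ← span_indMk, Submodule.span_le]
  rintro _ ⟨k, m, rfl⟩
  exact Submodule.mem_iSup_of_mem k⁻¹ ⟨_, ⟨m, rfl⟩, (indMk_eq_ind φ ρ k m).symm⟩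

/-- The representation induced from the sign representation of `𝔖_p × 𝔖_c` is the
representation on the functions on the `c`-element subsets, twisted by the sign. -/
theorem exists_indPair_col_equiv {p c N : ℕ} (h : p + c = N) :
    ∃ e : IndSpace (young₂ h) (boxtimes (specht (col p)) (specht (col c))) ≃ₗ[ℂ]
      (Slice N c → ℂ),
      ∀ g x, e (indPair h (specht (col p)) (specht (col c)) g x) = sliceRep N c g (e x) := by
  classical
  obtain ⟨e₁, he₁⟩ := exists_specht_col p
  obtain ⟨e₂, he₂⟩ := exists_specht_col c
  let r : Fin c → Fin N := fun i => finCongr h (Fin.natAdd p i)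
  have hr : Function.Injective r := (finCongr h).injective.comp (Fin.natAdd_injective c p)
  let S := rangeSlice r hr
  have hS (k : Fin N) : k ∈ S.1 ↔ p ≤ (k : ℕ) := by
    rw [mem_rangeSlice]
    constructor
    · rintro ⟨i, rfl⟩
      simp [r]
    · intro hk
      exact ⟨⟨k - p, by omega⟩, Fin.ext (by simp [r]; omega)⟩
  have hyoung (x) : S.move (young₂ h x) = S := by
    symm
    refine (Slice.move_inv_eq_iff _ _ _).1 ?_
    rw [← map_inv]
    refine (eq_rangeSlice hr fun i => ?_)
    rw [Slice.mem_move, ← map_inv, inv_inv, young₂_ge, hS]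
    simp
  let E : SpechtModule (col p) ⊗[ℂ] SpechtModule (col c) ≃ₗ[ℂ] ℂ :=
    (TensorProduct.congr e₁ e₂).trans (TensorProduct.lid ℂ ℂ)
  have hE (g x) : E (boxtimes (specht (col p)) (specht (col c)) g x) =
      csign (young₂ h g) * E x := by
    induction x using TensorProduct.induction_on with
    | zero => simp
    | add x y hx hy => rw [map_add, map_add, hx, hy, map_add, mul_add]
    | tmul x y =>
      obtain ⟨g, g'⟩ := g
      rw [boxtimes_tmul]
      simp only [E, LinearEquiv.trans_apply, TensorProduct.congr_tmul, TensorProduct.lid_tmul,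
        he₁, he₂, csign_young₂, smul_eq_mul]
      ring
  -- The line of the sign representation goes to the delta function at `S`, the set of the last `c`
  -- indices. The Young subgroup is the stabilizer of `S`, and the translates of `S` are all
  -- `c`-element subsets.
  let f : SpechtModule (col p) ⊗[ℂ] SpechtModule (col c) →ₗ[ℂ] (Slice N c → ℂ) :=
    LinearMap.single ℂ (fun _ => ℂ) S ∘ₗ E.toLinearMap
  have hfapp (x) : f x = Pi.single S (E x) := rfl
  have hf (g x) : f (boxtimes (specht (col p)) (specht (col c)) g x) =
      sliceRep N c (young₂ h g) (f x) := by
    rw [hfapp, hfapp, hE, sliceRep_single, hyoung, ← Pi.single_smul, smul_eq_mul]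
  let F := indLift (young₂ h) (boxtimes (specht (col p)) (specht (col c))) (sliceRep N c) f hf
  have hF (g x) : F (indPair h (specht (col p)) (specht (col c)) g x) = sliceRep N c g (F x) :=
    indLift_ind _ _ _ _ _ g x
  have hF1 (x) : F (indMk _ _ 1 x) = Pi.single S (E x) := by
    rw [indLift_indMk, inv_one, map_one, Module.End.one_apply, hfapp]
  have hindep : iSupIndep fun J : Slice N c => Submodule.span ℂ {(Pi.single J 1 : Slice N c → ℂ)} := by
    have := (Pi.basisFun ℂ (Slice N c)).linearIndependent.iSupIndep_span_singleton
    simpa only [Pi.basisFun_apply] using this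
  refine ⟨LinearEquiv.ofBijective F ⟨?_, ?_⟩, hF⟩
  · refine injective_of_graded (indPair h (specht (col p)) (specht (col c))) (sliceRep N c) F hF
      (indMk _ _ 1) (fun k => S.move k) _ hindep ?_ ?_ ?_ (iSup_range_indMk_one _ _)
    · intro k k' hk x
      have hfix : S.move (k'⁻¹ * k) = S := by
        rw [Slice.move_mul, hk, ← Slice.move_mul, inv_mul_cancel, Slice.move_one]
      obtain ⟨y, hy⟩ := exists_young₂_eq h (k'⁻¹ * k) fun i hi => by
        by_contra hcon
        have h1 : (k'⁻¹ * k) i ∈ (S.move (k'⁻¹ * k)).1 := by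
          rw [hfix, hS]; omega
        rw [Slice.mem_move, Equiv.Perm.inv_def, Equiv.symm_apply_apply, hS] at h1
        omega
      refine ⟨boxtimes (specht (col p)) (specht (col c)) y x, ?_⟩
      rw [← ind_map_indMk_one, hy]
      change _ = ind _ _ k' (ind _ _ _ _)
      rw [← Module.End.mul_apply, ← map_mul, mul_inv_cancel_left]
      rfl
    · intro k x
      rw [hF1, sliceRep_single]
      refine Submodule.smul_mem _ _ (Submodule.mem_span_singleton.2 ⟨E x, ?_⟩)
      rw [← Pi.single_smul, smul_eq_mul, mul_one]
    · intro x y hxy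
      simp only [LinearMap.coe_comp, Function.comp_apply, hF1] at hxy
      exact E.injective (Pi.single_injective S hxy)
  · rw [← LinearMap.range_eq_top, eq_top_iff, ← (Pi.basisFun ℂ (Slice N c)).span_eq,
      Submodule.span_le]
    rintro _ ⟨J, rfl⟩
    obtain ⟨σ, hσ⟩ := exists_move_eq S J
    refine ⟨indPair h (specht (col p)) (specht (col c)) σ (indMk _ _ 1 (E.symm (csign σ))), ?_⟩
    rw [hF, hF1, E.apply_symm_apply, sliceRep_single, hσ, ← Pi.single_smul, smul_eq_mul,
      csign_mul_self, Pi.basisFun_apply]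

/-! ### Monomials in the exterior algebra -/

/-- The basis of `(V ⊗ W)^*` dual to the basis `v_i ⊗ w_j`. -/
def coordBasis (n : ℕ) : Module.Basis (Fin n × Fin 2) ℂ (DualVW n) :=
  ((Pi.basisFun ℂ (Fin n)).tensorProduct (Pi.basisFun ℂ (Fin 2))).dualBasis

lemma coordBasis_tmul {n : ℕ} (k : Fin n × Fin 2) (v : Fin n → ℂ) (w : Fin 2 → ℂ) :
    coordBasis n k (v ⊗ₜ w) = v k.1 * w k.2 := by
  obtain ⟨i, j⟩ := k
  rw [coordBasis, Module.Basis.dualBasis_apply, Module.Basis.tensorProduct_repr_tmul_apply,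
    Pi.basisFun_repr, Pi.basisFun_repr, smul_eq_mul, mul_comm]

/-- The inverse in the contragredient cancels the one in the action on `V` and `W`, so the
coordinates have positive multidegree. -/
lemma dual_coordBasis {n : ℕ} (g : G n × G 2) (k : Fin n × Fin 2) :
    (boxtimes (stdRep n) (stdRep 2)).dual g (coordBasis n k) =
      ((g.1.left (g.1.right k.1) * g.2.left (g.2.right k.2) : ℂˣ) : ℂ) •
        coordBasis n (g.1.right k.1, g.2.right k.2) := by
  refine TensorProduct.ext' fun v w => ?_
  change coordBasis n k (boxtimes (stdRep n) (stdRep 2) g⁻¹ (v ⊗ₜ w)) =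
    ((g.1.left (g.1.right k.1) * g.2.left (g.2.right k.2) : ℂˣ) : ℂ) *
      coordBasis n (g.1.right k.1, g.2.right k.2) (v ⊗ₜ w)
  have h1 {m : ℕ} (g : G m) (v : Fin m → ℂ) (i : Fin m) :
      stdRep m g⁻¹ v i = (g.left (g.right i) : ℂ) * v (g.right i) := by
    change (((g⁻¹.left i)⁻¹ : ℂˣ) : ℂ) * v (g⁻¹.right⁻¹ i) = _
    have h2 : g⁻¹.left i = (g.left (g.right i))⁻¹ := by
      rw [SemidirectProduct.inv_left]
      change (g.left⁻¹) (g.right⁻¹⁻¹ • i) = _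
      rw [inv_inv]; rfl
    rw [h2, SemidirectProduct.inv_right, inv_inv, inv_inv]
  rw [show boxtimes (stdRep n) (stdRep 2) g⁻¹ (v ⊗ₜ w) = stdRep n g.1⁻¹ v ⊗ₜ stdRep 2 g.2⁻¹ w
    from rfl, coordBasis_tmul, coordBasis_tmul, h1, h1, Units.val_mul]
  ring

/-- The product of the coordinates given by a list of indices. -/
def monomial {n : ℕ} (l : List (Fin n × Fin 2)) : ExteriorAlgebra ℂ (DualVW n) :=
  (l.map fun k => ExteriorAlgebra.ι ℂ (coordBasis n k)).prod

lemma extRep_ι {n : ℕ} (g : G n × G 2) (k : Fin n × Fin 2) :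
    extRep n g (ExteriorAlgebra.ι ℂ (coordBasis n k)) =
      ((g.1.left (g.1.right k.1) * g.2.left (g.2.right k.2) : ℂˣ) : ℂ) •
        ExteriorAlgebra.ι ℂ (coordBasis n (g.1.right k.1, g.2.right k.2)) := by
  change ExteriorAlgebra.map ((boxtimes (stdRep n) (stdRep 2)).dual g)
    (ExteriorAlgebra.ι ℂ (coordBasis n k)) = _
  rw [ExteriorAlgebra.map_apply_ι, dual_coordBasis, map_smul]

lemma extRep_mul {n : ℕ} (g : G n × G 2) (x y : ExteriorAlgebra ℂ (DualVW n)) :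
    extRep n g (x * y) = extRep n g x * extRep n g y :=
  map_mul (ExteriorAlgebra.map ((boxtimes (stdRep n) (stdRep 2)).dual g)) x y

lemma extRep_one {n : ℕ} (g : G n × G 2) : extRep n g 1 = 1 :=
  map_one (ExteriorAlgebra.map ((boxtimes (stdRep n) (stdRep 2)).dual g))

lemma extRep_inl_monomial {n : ℕ} (s : Fin n → ℂˣ) (t : Fin 2 → ℂˣ)
    (l : List (Fin n × Fin 2)) :
    extRep n (SemidirectProduct.inl s, SemidirectProduct.inl t) (monomial l) =
      ((l.map fun k => s k.1 * t k.2).prod : ℂˣ) • monomial l := by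
  induction l with
  | nil => simp [monomial, extRep_one]
  | cons k l ih =>
    have h1 : monomial (k :: l) = ExteriorAlgebra.ι ℂ (coordBasis n k) * monomial l := by
      simp [monomial]
    rw [h1, extRep_mul, ih, extRep_ι, List.map_cons, List.prod_cons, mul_smul, Units.smul_def,
      Units.smul_def, Units.smul_def, Algebra.smul_mul_assoc, Algebra.mul_smul_comm]
    simp only [SemidirectProduct.left_inl, SemidirectProduct.right_inl, Equiv.Perm.one_apply,
      Units.val_mul, mul_smul]

lemma ι_mul_comm {M : Type*} [AddCommGroup M] [Module ℂ M] (x y : M) :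
    ExteriorAlgebra.ι ℂ x * ExteriorAlgebra.ι ℂ y =
      -(ExteriorAlgebra.ι ℂ y * ExteriorAlgebra.ι ℂ x) :=
  eq_neg_of_add_eq_zero_left (ExteriorAlgebra.ι_add_mul_swap x y)

lemma monomial_perm {n : ℕ} {l l' : List (Fin n × Fin 2)} (h : l.Perm l') :
    ∃ ε : ℂˣ, monomial l = ε • monomial l' := by
  induction h with
  | nil => exact ⟨1, by rw [one_smul]⟩
  | cons k _ ih =>
    obtain ⟨ε, hε⟩ := ih
    refine ⟨ε, ?_⟩
    simp only [monomial, List.map_cons, List.prod_cons] at hε ⊢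
    rw [hε, mul_smul_comm]
  | swap k k' l =>
    refine ⟨-1, ?_⟩
    simp only [monomial, List.map_cons, List.prod_cons]
    rw [← mul_assoc, ι_mul_comm, neg_mul, mul_assoc, Units.smul_def, Units.val_neg,
      Units.val_one, neg_smul, one_smul]
  | trans _ _ ih₁ ih₂ =>
    obtain ⟨ε₁, h₁⟩ := ih₁
    obtain ⟨ε₂, h₂⟩ := ih₂
    exact ⟨ε₁ * ε₂, by rw [h₁, h₂, mul_smul]⟩

/-- The monomials in distinct coordinates give a basis of the exterior algebra. -/
theorem exists_monomial_basis (n : ℕ) :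
    ∃ B : Module.Basis (Finset (Fin n × Fin 2)) ℂ (ExteriorAlgebra ℂ (DualVW n)),
      ∀ l : List (Fin n × Fin 2), l.Nodup → ∃ ε : ℂˣ, monomial l = ε • B l.toFinset := by
  classical
  -- The basis of the exterior algebra requires a linearly ordered index type. Any order serves,
  -- since reordering a monomial only multiplies it by a unit.
  let b : Module.Basis (Fin n ×ₗ Fin 2) ℂ (DualVW n) := (coordBasis n).reindex toLex
  have hb (k) : b k = coordBasis n (ofLex k) := by simp [b]
  let B := b.ExteriorAlgebra.reindex (toLex (α := Fin n × Fin 2)).symm.finsetCongr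
  refine ⟨B, fun l hl => ?_⟩
  let S := l.toFinset.map (toLex (α := Fin n × Fin 2)).toEmbedding
  have hB : B l.toFinset = b.ExteriorAlgebra S := by
    simp only [B, Module.Basis.reindex_apply]
    rfl
  let f := Set.powersetCard.ofFinEmbEquiv.symm (Set.powersetCard.ofCard (rfl : S.card = S.card))
  have hmon : b.ExteriorAlgebra S = monomial (List.ofFn fun i => ofLex (f i)) := by
    rw [ExteriorAlgebra.basis_apply_ofCard b rfl, monomial, List.map_ofFn]
    change ExteriorAlgebra.ιMulti ℂ _ _ = _
    rw [ExteriorAlgebra.ιMulti_apply]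
    exact congrArg List.prod (congrArg List.ofFn (funext fun i =>
      congrArg (ExteriorAlgebra.ι ℂ) (hb (f i))))
  have hperm : l.Perm (List.ofFn fun i => ofLex (f i)) := by
    refine (List.perm_ext_iff_of_nodup hl (List.nodup_ofFn.2 ?_)).2 fun k => ?_
    · exact (ofLex (α := Fin n × Fin 2)).injective.comp f.injective
    · rw [List.mem_ofFn]
      have h1 := Set.powersetCard.mem_range_ofFinEmbEquiv_symm_iff_mem
        (Set.powersetCard.ofCard (rfl : S.card = S.card)) (toLex k)
      have h2 : toLex k ∈ S ↔ k ∈ l := by simp [S]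
      rw [← h2]
      exact h1.symm
  rw [hB, hmon]
  exact monomial_perm hperm

/-! ### The components of the exterior algebra -/

/-- The degree of a monomial with respect to a coordinate of the first torus. -/
def rowDeg {n : ℕ} (S : Finset (Fin n × Fin 2)) (i : Fin n) : ℕ :=
  ∑ j, if (i, j) ∈ S then 1 else 0

/-- The degree of a monomial with respect to a coordinate of the second torus. -/
def colDeg {n : ℕ} (S : Finset (Fin n × Fin 2)) (j : Fin 2) : ℕ :=
  ∑ i, if (i, j) ∈ S then 1 else 0

lemma prod_eq_torusChar {n : ℕ} (S : Finset (Fin n × Fin 2)) (s : Fin n → ℂˣ) (t : Fin 2 → ℂˣ) :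
    ∏ k ∈ S, (s k.1 * t k.2) =
      torusChar (fun i => (rowDeg S i : ℤ)) s * torusChar (fun j => (colDeg S j : ℤ)) t := by
  have h1 : ∏ k ∈ S, s k.1 = torusChar (fun i => (rowDeg S i : ℤ)) s := by
    change _ = ∏ i, s i ^ (rowDeg S i : ℤ)
    simp only [zpow_natCast, rowDeg, ← Finset.prod_pow_eq_pow_sum]
    rw [← Fintype.prod_prod_type' (f := fun i j => s i ^ (if (i, j) ∈ S then 1 else 0))]
    simp only [Prod.mk.eta, pow_ite, pow_one, pow_zero]
    rw [Finset.prod_ite_mem, Finset.univ_inter]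
  have h2 : ∏ k ∈ S, t k.2 = torusChar (fun j => (colDeg S j : ℤ)) t := by
    change _ = ∏ j, t j ^ (colDeg S j : ℤ)
    simp only [zpow_natCast, colDeg, ← Finset.prod_pow_eq_pow_sum]
    rw [Finset.prod_comm,
      ← Fintype.prod_prod_type' (f := fun i j => t j ^ (if (i, j) ∈ S then 1 else 0))]
    simp only [Prod.mk.eta, pow_ite, pow_one, pow_zero]
    rw [Finset.prod_ite_mem, Finset.univ_inter]
  rw [Finset.prod_mul_distrib, h1, h2]

lemma extRep_inl_monomial_of_nodup {n : ℕ} {l : List (Fin n × Fin 2)} (hl : l.Nodup)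
    (s : Fin n → ℂˣ) (t : Fin 2 → ℂˣ) :
    extRep n (SemidirectProduct.inl s, SemidirectProduct.inl t) (monomial l) =
      (torusChar (fun i => (rowDeg l.toFinset i : ℤ)) s *
        torusChar (fun j => (colDeg l.toFinset j : ℤ)) t : ℂˣ) • monomial l := by
  rw [extRep_inl_monomial, ← prod_eq_torusChar, List.prod_toFinset _ hl]

lemma character_injective {n m : ℕ} {d d' : Fin n → ℤ} {e e' : Fin m → ℤ}
    (h : ∀ s t, torusChar d s * torusChar e t = torusChar d' s * torusChar e' t) :
    d = d' ∧ e = e' := by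
  refine ⟨torusChar_injective n (DFunLike.ext _ _ fun s => ?_),
    torusChar_injective m (DFunLike.ext _ _ fun t => ?_)⟩
  · simpa using h s 1
  · simpa using h 1 t

/-- The torus acts diagonally on monomials. Comparing a nonzero coefficient of `v` before and after
the action equates the two characters, and hence the multidegrees. -/
lemma weightSpace_extRep_le {n : ℕ}
    (B : Module.Basis (Finset (Fin n × Fin 2)) ℂ (ExteriorAlgebra ℂ (DualVW n)))
    (hB : ∀ l : List (Fin n × Fin 2), l.Nodup → ∃ ε : ℂˣ, monomial l = ε • B l.toFinset)
    (d : Fin n → ℤ) (e : Fin 2 → ℤ) :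
    weightSpace (extRep n) d e ≤ Submodule.span ℂ
      (B '' {S | (fun i => (rowDeg S i : ℤ)) = d ∧ (fun j => (colDeg S j : ℤ)) = e}) := by
  classical
  intro v hv
  have hBS (S s t) : extRep n (SemidirectProduct.inl s, SemidirectProduct.inl t) (B S) =
      ((torusChar (fun i => (rowDeg S i : ℤ)) s *
        torusChar (fun j => (colDeg S j : ℤ)) t : ℂˣ) : ℂ) • B S := by
    obtain ⟨ε, hε⟩ := hB S.toList S.nodup_toList
    have h1 := extRep_inl_monomial_of_nodup S.nodup_toList s t
    rw [hε, Finset.toList_toFinset, Units.smul_def, map_smul, Units.smul_def, smul_comm] at h1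
    exact MulAction.injective ε h1
  have hcoeff (S s t) :
      B.repr (extRep n (SemidirectProduct.inl s, SemidirectProduct.inl t) v) S =
      ((torusChar (fun i => (rowDeg S i : ℤ)) s *
        torusChar (fun j => (colDeg S j : ℤ)) t : ℂˣ) : ℂ) * B.repr v S := by
    suffices B.coord S ∘ₗ extRep n (SemidirectProduct.inl s, SemidirectProduct.inl t) =
        ((torusChar (fun i => (rowDeg S i : ℤ)) s *
        torusChar (fun j => (colDeg S j : ℤ)) t : ℂˣ) : ℂ) • B.coord S from
      LinearMap.congr_fun this v
    refine B.ext fun S' => ?_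
    simp only [LinearMap.comp_apply, LinearMap.smul_apply, hBS, map_smul, Module.Basis.coord_apply,
      Module.Basis.repr_self]
    rcases eq_or_ne S' S with rfl | hne
    · rfl
    · rw [Finsupp.single_eq_of_ne (Ne.symm hne), smul_zero, smul_zero]
  rw [Module.Basis.mem_span_image]
  intro S hS
  have hS0 : B.repr v S ≠ 0 := Finsupp.mem_support_iff.1 hS
  refine character_injective fun s t => Units.ext (mul_right_cancel₀ hS0 ?_)
  rw [← hcoeff, hv s t, map_smul, Finsupp.smul_apply, smul_eq_mul]

/-! ### Monomials of block multidegree -/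

section Blocks

variable {a b r : ℕ}

/-- The indices of the monomial `∏ i < a, x_{i,0} x_{i,1}`. -/
def fullList (a b r : ℕ) : List (Fin (a + (b + r)) × Fin 2) :=
  (List.ofFn fun i : Fin a => [(Fin.castAdd (b + r) i, 0), (Fin.castAdd (b + r) i, 1)]).flatten

/-- The index of one of the coordinates `x_{i,0}` or `x_{i,1}` in the second block. -/
def halfIndex (a r : ℕ) (J : Finset (Fin b)) (i : Fin b) : Fin (a + (b + r)) × Fin 2 :=
  (Fin.natAdd a (Fin.castAdd r i), if i ∈ J then 1 else 0)

/-- The indices of a monomial that is of degree two in the first block and of degree one in the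
second block. -/
def blockList (a r : ℕ) (J : Finset (Fin b)) : List (Fin (a + (b + r)) × Fin 2) :=
  fullList a b r ++ List.ofFn (halfIndex a r J)

lemma halfIndex_injective (J : Finset (Fin b)) : Function.Injective (halfIndex a r J) := by
  intro i i' h
  exact Fin.castAdd_injective b r (Fin.natAdd_injective (b + r) a (Prod.ext_iff.1 h).1)

lemma mem_fullList (k : Fin (a + (b + r)) × Fin 2) :
    k ∈ fullList a b r ↔ ∃ i, k.1 = Fin.castAdd (b + r) i := by
  rw [fullList, List.mem_flatten]
  constructor
  · rintro ⟨l, hl, hk⟩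
    obtain ⟨i, rfl⟩ := List.mem_ofFn.1 hl
    refine ⟨i, ?_⟩
    simp only [List.mem_cons, List.not_mem_nil, or_false] at hk
    rcases hk with rfl | rfl <;> rfl
  · rintro ⟨i, hi⟩
    refine ⟨_, List.mem_ofFn.2 ⟨i, rfl⟩, ?_⟩
    obtain ⟨k, j⟩ := k
    obtain rfl : k = _ := hi
    fin_cases j <;> simp

lemma blockList_nodup (J : Finset (Fin b)) : (blockList a r J).Nodup := by
  rw [blockList, List.nodup_append]
  refine ⟨?_, List.nodup_ofFn.2 (halfIndex_injective J), ?_⟩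
  · rw [fullList, List.nodup_flatten]
    refine ⟨fun l hl => ?_, ?_⟩
    · obtain ⟨i, rfl⟩ := List.mem_ofFn.1 hl
      simp
    · rw [List.pairwise_ofFn]
      intro i i' hi
      simp only [List.disjoint_cons_left, List.mem_cons, Prod.mk.injEq, List.not_mem_nil,
        or_false, Fin.castAdd_inj, List.disjoint_nil_left, and_true]
      have := hi.ne
      tauto
  · intro k hk k' hk' hkk
    subst hkk
    obtain ⟨i, hi⟩ := (mem_fullList k).1 hk
    obtain ⟨i', rfl⟩ := List.mem_ofFn.1 hk'
    have h1 := congrArg Fin.val hi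
    simp only [halfIndex, Fin.val_natAdd, Fin.val_castAdd] at h1
    omega

lemma left_mem_blockList (J : Finset (Fin b)) (i : Fin a) (j : Fin 2) :
    (Fin.castAdd (b + r) i, j) ∈ (blockList a r J).toFinset := by
  rw [List.mem_toFinset, blockList, List.mem_append, mem_fullList]
  exact Or.inl ⟨i, rfl⟩

lemma middle_mem_blockList (J : Finset (Fin b)) (i : Fin b) (j : Fin 2) :
    (Fin.natAdd a (Fin.castAdd r i), j) ∈ (blockList a r J).toFinset ↔
      j = if i ∈ J then 1 else 0 := by
  rw [List.mem_toFinset, blockList, List.mem_append, mem_fullList, List.mem_ofFn]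
  constructor
  · rintro (⟨i', hi⟩ | ⟨i', hi⟩)
    · have h1 := congrArg Fin.val hi
      simp only [Fin.val_natAdd, Fin.val_castAdd] at h1
      omega
    · obtain ⟨h1, h2⟩ := Prod.ext_iff.1 hi
      obtain rfl := Fin.castAdd_injective b r (Fin.natAdd_injective (b + r) a h1)
      exact h2.symm
  · rintro rfl
    exact Or.inr ⟨i, rfl⟩

lemma right_notMem_blockList (J : Finset (Fin b)) (i : Fin r) (j : Fin 2) :
    (Fin.natAdd a (Fin.natAdd b i), j) ∉ (blockList a r J).toFinset := by
  rw [List.mem_toFinset, blockList, List.mem_append, mem_fullList, List.mem_ofFn]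
  rintro (⟨i', hi⟩ | ⟨i', hi⟩)
  · have h1 := congrArg Fin.val hi
    simp only [Fin.val_natAdd, Fin.val_castAdd] at h1
    omega
  · have h1 := congrArg Fin.val (Prod.ext_iff.1 hi).1
    simp only [halfIndex, Fin.val_natAdd, Fin.val_castAdd] at h1
    omega

lemma blockDeg_left (i : Fin a) : blockDeg (a + (b + r)) a b 2 1 0 (Fin.castAdd (b + r) i) = 2 := by
  simp [blockDeg]

lemma blockDeg_middle (i : Fin b) :
    blockDeg (a + (b + r)) a b 2 1 0 (Fin.natAdd a (Fin.castAdd r i)) = 1 := by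
  simp [blockDeg]

lemma blockDeg_right (i : Fin r) :
    blockDeg (a + (b + r)) a b 2 1 0 (Fin.natAdd a (Fin.natAdd b i)) = 0 := by
  simp [blockDeg]

lemma rowDeg_blockList (J : Finset (Fin b)) :
    (fun i => (rowDeg (blockList a r J).toFinset i : ℤ)) = blockDeg (a + (b + r)) a b 2 1 0 := by
  funext i
  rw [rowDeg, Fin.sum_univ_two]
  induction i using Fin.addCases with
  | left i => simp only [left_mem_blockList, if_true, blockDeg_left]; norm_num
  | right i =>
    induction i using Fin.addCases with
    | left i =>
      simp only [middle_mem_blockList, blockDeg_middle]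
      by_cases h : i ∈ J <;> simp [h]
    | right i => simp only [right_notMem_blockList, if_false, blockDeg_right]; norm_num

lemma colDeg_blockList_one (J : Finset (Fin b)) :
    colDeg (blockList a r J).toFinset 1 = a + J.card := by
  rw [colDeg, Fin.sum_univ_add, Fin.sum_univ_add]
  simp only [left_mem_blockList, middle_mem_blockList, right_notMem_blockList, if_true, if_false]
  have h1 : ∑ i : Fin b, (if (1 : Fin 2) = (if i ∈ J then 1 else 0) then 1 else 0) = J.card := by
    rw [Finset.card_eq_sum_ones, ← Finset.sum_filter]
    refine Finset.sum_congr ?_ fun _ _ => rfl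
    ext i
    by_cases h : i ∈ J <;> simp [h]
  rw [h1]
  simp

lemma colDeg_blockList_zero (J : Finset (Fin b)) :
    colDeg (blockList a r J).toFinset 0 + J.card = a + b := by
  rw [colDeg, Fin.sum_univ_add, Fin.sum_univ_add]
  simp only [left_mem_blockList, middle_mem_blockList, right_notMem_blockList, if_true, if_false]
  have h1 : ∑ i : Fin b, (if (0 : Fin 2) = (if i ∈ J then 1 else 0) then 1 else 0) = Jᶜ.card := by
    rw [Finset.card_eq_sum_ones, ← Finset.sum_filter]
    refine Finset.sum_congr ?_ fun _ _ => rfl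
    ext i
    by_cases h : i ∈ J <;> simp [h]
  have h2 := Finset.card_add_card_compl J
  rw [Fintype.card_fin] at h2
  rw [h1]
  simp
  omega

lemma eq_blockList_of_rowDeg (S : Finset (Fin (a + (b + r)) × Fin 2))
    (hS : (fun i => (rowDeg S i : ℤ)) = blockDeg (a + (b + r)) a b 2 1 0) :
    ∃ J : Finset (Fin b), S = (blockList a r J).toFinset := by
  classical
  have hrow (i) : ((if (i, 0) ∈ S then 1 else 0) + (if (i, 1) ∈ S then 1 else 0) : ℤ) =
      blockDeg (a + (b + r)) a b 2 1 0 i := by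
    rw [← hS]
    simp only [rowDeg, Fin.sum_univ_two]
    push_cast
    rfl
  -- Row degree `1` leaves one choice of column in each row of the second block, and `J` records the
  -- rows where it is the second column. Degrees `2` and `0` leave no choice.
  refine ⟨Finset.univ.filter fun i => (Fin.natAdd a (Fin.castAdd r i), (1 : Fin 2)) ∈ S, ?_⟩
  ext ⟨i, j⟩
  induction i using Fin.addCases with
  | left i =>
    have h1 := hrow (Fin.castAdd (b + r) i)
    rw [blockDeg_left] at h1
    simp only [left_mem_blockList, iff_true]
    fin_cases j <;> simp only [Fin.zero_eta, Fin.mk_one] <;> by_contra hc <;>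
      split_ifs at h1 <;> simp_all
  | right i =>
    induction i using Fin.addCases with
    | left i =>
      have h1 := hrow (Fin.natAdd a (Fin.castAdd r i))
      rw [blockDeg_middle] at h1
      simp only [middle_mem_blockList, Finset.mem_filter, Finset.mem_univ, true_and]
      fin_cases j <;> simp only [Fin.zero_eta, Fin.mk_one] <;>
        split_ifs at h1 ⊢ <;> simp_all
    | right i =>
      have h1 := hrow (Fin.natAdd a (Fin.natAdd b i))
      rw [blockDeg_right] at h1
      simp only [right_notMem_blockList, iff_false]
      fin_cases j <;> simp only [Fin.zero_eta, Fin.mk_one] <;> intro hc <;>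
        split_ifs at h1 <;> simp_all

/-- The map from functions on the `c`-element subsets of the second block to the exterior
algebra. -/
def blockMap (a b r c : ℕ) : (Slice b c → ℂ) →ₗ[ℂ] ExteriorAlgebra ℂ (DualVW (a + (b + r))) :=
  Fintype.linearCombination ℂ fun J : Slice b c => monomial (blockList a r J.1)

lemma blockMap_apply (c : ℕ) (f : Slice b c → ℂ) :
    blockMap a b r c f = ∑ J, f J • monomial (blockList a r J.1) := rfl

lemma blockMap_single (c : ℕ) (J : Slice b c) (u : ℂ) :
    blockMap a b r c (Pi.single J u) = u • monomial (blockList a r J.1) := by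
  classical
  exact Fintype.linearCombination_apply_single ℂ _ J u

theorem blockMap_injective (a b r c : ℕ) : Function.Injective (blockMap a b r c) := by
  classical
  obtain ⟨B, hB⟩ := exists_monomial_basis (a + (b + r))
  choose ε hε using fun J : Slice b c => hB _ (blockList_nodup (a := a) (r := r) J.1)
  have hinj : Function.Injective fun J : Slice b c => (blockList a r J.1).toFinset := by
    intro J J' h
    refine Slice.ext_mem fun i => ?_
    have h1 := congrArg (fun S => (Fin.natAdd a (Fin.castAdd r i), (1 : Fin 2)) ∈ S) h
    simp only [middle_mem_blockList, eq_iff_iff] at h1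
    by_cases h2 : i ∈ J.1 <;> by_cases h3 : i ∈ J'.1 <;> simp_all
  have hli : LinearIndependent ℂ fun J : Slice b c => monomial (blockList a r J.1) := by
    have := (B.linearIndependent.comp _ hinj).units_smul ε
    convert this using 1
    funext J
    exact hε J
  exact linearIndependent_iff_injective_fintypeLinearCombination.1 hli

theorem range_blockMap (a b r c : ℕ) :
    LinearMap.range (blockMap a b r c) = weightSpace (extRep (a + (b + r)))
      (blockDeg (a + (b + r)) a b 2 1 0) ![(a : ℤ) + b - c, (a : ℤ) + c] := by
  classical
  apply le_antisymm
  · rintro _ ⟨f, rfl⟩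
    rw [blockMap_apply]
    refine Submodule.sum_mem _ fun J _ => Submodule.smul_mem _ _ fun s t => ?_
    rw [extRep_inl_monomial_of_nodup (blockList_nodup _), rowDeg_blockList, Units.smul_def]
    congr 4
    refine congrArg torusChar (funext fun j => ?_)
    have h0 := colDeg_blockList_zero (a := a) (r := r) J.1
    have h1 := colDeg_blockList_one (a := a) (r := r) J.1
    rw [J.2] at h0 h1
    fin_cases j <;> simp <;> omega
  · obtain ⟨B, hB⟩ := exists_monomial_basis (a + (b + r))
    refine (weightSpace_extRep_le B hB _ _).trans (Submodule.span_le.2 ?_)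
    rintro _ ⟨S, ⟨hS1, hS2⟩, rfl⟩
    obtain ⟨J, rfl⟩ := eq_blockList_of_rowDeg S hS1
    have hJ : J.card = c := by
      have h1 := congrFun hS2 1
      rw [colDeg_blockList_one] at h1
      simp at h1
      exact h1
    obtain ⟨ε, hε⟩ := hB _ (blockList_nodup (a := a) (r := r) J)
    refine ⟨Pi.single ⟨J, hJ⟩ ((ε⁻¹ : ℂˣ) : ℂ), ?_⟩
    rw [blockMap_single, hε, Units.smul_def, smul_smul, Units.inv_mul, one_smul]

end Blocks

/-! ### The action of the permutations on the components of the exterior algebra -/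

section Blocks

variable {a b r : ℕ}

lemma young₃_left (x : Equiv.Perm (Fin a) × Equiv.Perm (Fin b) × Equiv.Perm (Fin r)) (i : Fin a) :
    young₃ (rfl : a + (b + r) = _) x (Fin.castAdd (b + r) i) = Fin.castAdd (b + r) (x.1 i) :=
  young₂_lt (rfl : a + (b + r) = _) (x.1, young₂ rfl x.2) i

lemma young₃_middle (x : Equiv.Perm (Fin a) × Equiv.Perm (Fin b) × Equiv.Perm (Fin r))
    (i : Fin b) :
    young₃ (rfl : a + (b + r) = _) x (Fin.natAdd a (Fin.castAdd r i)) =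
      Fin.natAdd a (Fin.castAdd r (x.2.1 i)) :=
  (young₂_ge (rfl : a + (b + r) = _) (x.1, young₂ rfl x.2) (Fin.castAdd r i)).trans
    (congrArg (Fin.natAdd a) (young₂_lt (rfl : b + r = _) x.2 i))

lemma prod_ofFn_smul {A : Type*} [Ring A] [Algebra ℂ A] {m : ℕ} (u : ℂ) (z : Fin m → A) :
    (List.ofFn fun i => u • z i).prod = u ^ m • (List.ofFn z).prod := by
  induction m with
  | zero => simp
  | succ m ih =>
    rw [List.ofFn_succ, List.ofFn_succ, List.prod_cons, List.prod_cons, ih, smul_mul_smul_comm,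
      pow_succ']

lemma prod_ofFn_perm {A : Type*} [Ring A] {m : ℕ} (z : Fin m → A)
    (hz : ∀ i j, z i * z j = z j * z i) (σ : Equiv.Perm (Fin m)) :
    (List.ofFn fun i => z (σ i)).prod = (List.ofFn z).prod := by
  refine (σ.ofFn_comp_perm z).prod_eq' ?_
  rw [List.pairwise_ofFn]
  exact fun _ _ _ => hz _ _

lemma monomial_append {n : ℕ} (l l' : List (Fin n × Fin 2)) :
    monomial (l ++ l') = monomial l * monomial l' := by
  simp [monomial]

/-- The product `x_{i,0} x_{i,1}`. -/
def pairMonomial {n : ℕ} (i : Fin n) : ExteriorAlgebra ℂ (DualVW n) :=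
  ExteriorAlgebra.ι ℂ (coordBasis n (i, 0)) * ExteriorAlgebra.ι ℂ (coordBasis n (i, 1))

/-- A product of two elements of degree one is even, hence commutes with every element of degree
one. -/
lemma pairMonomial_comm {n : ℕ} (i j : Fin n) :
    pairMonomial i * pairMonomial j = pairMonomial j * pairMonomial i := by
  have key (x y z : DualVW n) : ExteriorAlgebra.ι ℂ x *
      (ExteriorAlgebra.ι ℂ y * ExteriorAlgebra.ι ℂ z) =
      (ExteriorAlgebra.ι ℂ y * ExteriorAlgebra.ι ℂ z) * ExteriorAlgebra.ι ℂ x := by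
    rw [← mul_assoc, ι_mul_comm x y, neg_mul, mul_assoc, ι_mul_comm x z, mul_neg, neg_neg,
      mul_assoc]
  unfold pairMonomial
  rw [mul_assoc, key, ← mul_assoc, key, mul_assoc]

lemma monomial_fullList : monomial (fullList a b r) =
    (List.ofFn fun i : Fin a => pairMonomial (Fin.castAdd (b + r) i)).prod := by
  rw [monomial, fullList, List.map_flatten, List.prod_flatten, List.map_ofFn, List.map_ofFn]
  congr 2
  funext i
  simp [pairMonomial]

lemma extRep_inr_ι {n : ℕ} (σ : Equiv.Perm (Fin n)) (τ : Equiv.Perm (Fin 2))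
    (k : Fin n × Fin 2) :
    extRep n (SemidirectProduct.inr σ, SemidirectProduct.inr τ)
      (ExteriorAlgebra.ι ℂ (coordBasis n k)) =
      ExteriorAlgebra.ι ℂ (coordBasis n (σ k.1, τ k.2)) := by
  rw [extRep_ι]
  simp

lemma extRep_prod {n : ℕ} (g : G n × G 2) (l : List (ExteriorAlgebra ℂ (DualVW n))) :
    extRep n g l.prod = (l.map (extRep n g)).prod :=
  map_list_prod (ExteriorAlgebra.map ((boxtimes (stdRep n) (stdRep 2)).dual g)) l

lemma perm_two (τ : Equiv.Perm (Fin 2)) : τ = 1 ∨ τ = Equiv.swap 0 1 := by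
  decide +revert

lemma extRep_inr_pairMonomial {n : ℕ} (σ : Equiv.Perm (Fin n)) (τ : Equiv.Perm (Fin 2))
    (i : Fin n) :
    extRep n (SemidirectProduct.inr σ, SemidirectProduct.inr τ) (pairMonomial i) =
      csign τ • pairMonomial (σ i) := by
  rw [pairMonomial, extRep_mul, extRep_inr_ι, extRep_inr_ι]
  rcases perm_two τ with rfl | rfl
  · simp [csign, pairMonomial]
  · simp only [Equiv.swap_apply_left, Equiv.swap_apply_right, pairMonomial]
    rw [ι_mul_comm]
    simp [csign]

/-- The action of permutations on a monomial. -/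
lemma extRep_inr_monomial_blockList
    (x : Equiv.Perm (Fin a) × Equiv.Perm (Fin b) × Equiv.Perm (Fin r)) (τ : Equiv.Perm (Fin 2))
    (J J' : Finset (Fin b))
    (hJ : ∀ i, (if x.2.1 i ∈ J' then 1 else 0) = τ (if i ∈ J then 1 else 0)) :
    extRep (a + (b + r)) (SemidirectProduct.inr (young₃ rfl x), SemidirectProduct.inr τ)
      (monomial (blockList a r J)) =
      (csign τ ^ a * csign x.2.1) • monomial (blockList a r J') := by
  have hmon (J : Finset (Fin b)) : monomial (List.ofFn (halfIndex a r J)) =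
      ExteriorAlgebra.ιMulti ℂ b fun i => coordBasis _ (halfIndex a r J i) := by
    rw [monomial, List.map_ofFn, ExteriorAlgebra.ιMulti_apply]
    rfl
  -- In the first block the commuting pairs can be permuted without a sign, and each of the `a`
  -- pairs contributes the sign of `τ`.
  have h1 : extRep (a + (b + r)) (SemidirectProduct.inr (young₃ rfl x), SemidirectProduct.inr τ)
      (monomial (fullList a b r)) = csign τ ^ a • monomial (fullList a b r) := by
    rw [monomial_fullList, extRep_prod, List.map_ofFn]
    simp only [Function.comp_def, extRep_inr_pairMonomial, young₃_left]
    rw [prod_ofFn_smul, prod_ofFn_perm (fun i => pairMonomial (Fin.castAdd (b + r) i))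
      fun _ _ => pairMonomial_comm _ _]
  have h2 : extRep (a + (b + r)) (SemidirectProduct.inr (young₃ rfl x), SemidirectProduct.inr τ)
      (monomial (List.ofFn (halfIndex a r J))) =
      csign x.2.1 • monomial (List.ofFn (halfIndex a r J')) := by
    -- In the second block the monomial is alternating in its `b` factors, so restoring their order
    -- costs the sign of the permutation.
    have h3 := AlternatingMap.map_perm (ExteriorAlgebra.ιMulti ℂ b)
      (fun i => coordBasis _ (halfIndex a r J' i)) x.2.1
    rw [hmon J', csign, Int.cast_smul_eq_zsmul, ← Units.smul_def, ← h3,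
      ExteriorAlgebra.ιMulti_apply, monomial, extRep_prod, List.map_ofFn, List.map_ofFn]
    congr 2
    funext i
    simp only [Function.comp_apply, extRep_inr_ι, halfIndex, young₃_middle, hJ]
  rw [blockList, blockList, monomial_append, monomial_append, extRep_mul, h1, h2,
    smul_mul_smul_comm]

theorem blockMap_sliceRep {c : ℕ}
    (x : Equiv.Perm (Fin a) × Equiv.Perm (Fin b) × Equiv.Perm (Fin r)) (f : Slice b c → ℂ) :
    blockMap a b r c (sliceRep b c x.2.1 f) =
      extRep (a + (b + r)) (SemidirectProduct.inr (young₃ rfl x), SemidirectProduct.inr 1)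
        (blockMap a b r c f) := by
  suffices blockMap a b r c ∘ₗ sliceRep b c x.2.1 =
      extRep (a + (b + r)) (SemidirectProduct.inr (young₃ rfl x), SemidirectProduct.inr 1) ∘ₗ
        blockMap a b r c from LinearMap.congr_fun this f
  refine (Pi.basisFun ℂ (Slice b c)).ext fun J => ?_
  rw [LinearMap.comp_apply, LinearMap.comp_apply, Pi.basisFun_apply, sliceRep_single, map_smul,
    blockMap_single, blockMap_single, one_smul, one_smul,
    extRep_inr_monomial_blockList x 1 J.1 (J.move x.2.1).1 fun i => by simp [Slice.mem_move]]
  simp [csign]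

theorem blockMap_complMap {c : ℕ} (f : Slice (2 * c) c → ℂ) :
    extRep (a + (2 * c + r)) (SemidirectProduct.inr 1, SemidirectProduct.inr (Equiv.swap 0 1))
        (blockMap a (2 * c) r c f) = (-1 : ℂ) ^ a • blockMap a (2 * c) r c (complMap c f) := by
  suffices extRep (a + (2 * c + r))
      (SemidirectProduct.inr 1, SemidirectProduct.inr (Equiv.swap 0 1)) ∘ₗ
        blockMap a (2 * c) r c = (-1 : ℂ) ^ a • blockMap a (2 * c) r c ∘ₗ complMap c from
    LinearMap.congr_fun this f
  refine (Pi.basisFun ℂ (Slice (2 * c) c)).ext fun J => ?_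
  have hcompl : complMap c (Pi.single J 1) = Pi.single J.compl 1 := by
    classical
    funext J'
    have : J'.compl = J ↔ J' = J.compl := by
      have hcc (J : Slice (2 * c) c) : J.compl.compl = J := Subtype.ext (compl_compl J.1)
      exact ⟨fun h => by rw [← h, hcc], fun h => by rw [h, hcc]⟩
    simp [complMap_apply, Pi.single_apply, this]
  have h := extRep_inr_monomial_blockList (a := a) (r := r) 1 (Equiv.swap 0 1) J.1 J.compl.1
    fun i => by by_cases hi : i ∈ J.1 <;> simp [Slice.compl, hi]
  rw [map_one] at h
  rw [LinearMap.comp_apply, LinearMap.smul_apply, LinearMap.comp_apply, Pi.basisFun_apply, hcompl,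
    blockMap_single, blockMap_single, one_smul, one_smul, h]
  simp [csign]

end Blocks

/-! ### Recognizing the representations attached to a multidegree -/

section Recognition

variable {n m : ℕ} {H H' : Type*} [Group H] [Group H'] (φ : H →* Equiv.Perm (Fin n))
  (ψ : H' →* Equiv.Perm (Fin m)) (d : Fin n → ℤ) (e : Fin m → ℤ)
  (hd : ∀ h i, d (φ h i) = d i) (he : ∀ h i, e (ψ h i) = e i)
  {B : Type*} [AddCommGroup B] [Module ℂ B] (π : Representation ℂ (G n × G m) B)

lemma eq_torusExtHom (g : G n) {h : H} (hg : φ h = g.right) :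
    g = torusExtHom φ (⟨g.left, h⟩ : TorusExt φ) :=
  SemidirectProduct.ext rfl hg.symm

lemma torusExtHom_eq_inl_mul_inr (x : TorusExt φ) :
    torusExtHom φ x = SemidirectProduct.inl x.left * SemidirectProduct.inr (φ x.right) := by
  exact (SemidirectProduct.inl_left_mul_inr_right (torusExtHom φ x)).symm

section Single

variable {M N : Type*} [AddCommGroup M] [Module ℂ M] [AddCommGroup N] [Module ℂ N]
  (ρ : Representation ℂ H M) (σ : Representation ℂ H' N)

lemma map_twist_tmul (f : M ⊗[ℂ] N →ₗ[ℂ] B) (hw : ∀ x, f x ∈ weightSpace π d e)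
    (hf : ∀ h h' u v, f (ρ h u ⊗ₜ σ h' v) =
      π (SemidirectProduct.inr (φ h), SemidirectProduct.inr (ψ h')) (f (u ⊗ₜ v)))
    (x : TorusExt φ) (y : TorusExt ψ) (u : M) (v : N) :
    f (twist φ d hd ρ x u ⊗ₜ twist ψ e he σ y v) =
      π (torusExtHom φ x, torusExtHom ψ y) (f (u ⊗ₜ v)) := by
  rw [torusExtHom_eq_inl_mul_inr, torusExtHom_eq_inl_mul_inr, ← Prod.mk_mul_mk, map_mul,
    Module.End.mul_apply, ← hf, hw]
  change f ((((torusChar d x.left : ℂˣ) : ℂ) • ρ x.right u) ⊗ₜ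
    (((torusChar e y.left : ℂˣ) : ℂ) • σ y.right v)) = _
  rw [TensorProduct.smul_tmul_smul, map_smul, Units.val_mul]

/-- The inclusion of `M ⊗ N` in the external product of the induced representations. -/
def indInclusion : M ⊗[ℂ] N →ₗ[ℂ]
    IndSpace (torusExtHom φ) (twist φ d hd ρ) ⊗[ℂ] IndSpace (torusExtHom ψ) (twist ψ e he σ) :=
  TensorProduct.map (indMk _ _ 1) (indMk _ _ 1)

lemma boxtimes_indInclusion (x : TorusExt φ) (y : TorusExt ψ) (z : M ⊗[ℂ] N) :
    boxtimes (orbitRep φ d hd ρ) (orbitRep ψ e he σ) (torusExtHom φ x, torusExtHom ψ y)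
      (indInclusion φ ψ d e hd he ρ σ z) =
    indInclusion φ ψ d e hd he ρ σ (boxtimes (twist φ d hd ρ) (twist ψ e he σ) (x, y) z) := by
  induction z using TensorProduct.induction_on with
  | zero => simp
  | add z z' hz hz' => simp only [map_add, hz, hz']
  | tmul u v =>
    rw [boxtimes_tmul, indInclusion, TensorProduct.map_tmul, TensorProduct.map_tmul, boxtimes_tmul]
    exact congrArg₂ (fun x y => x ⊗ₜ[ℂ] y) (ind_map_indMk_one _ _ x u) (ind_map_indMk_one _ _ y v)

/-- By `hφ` and `hψ` the groups `H` and `H'` surject onto the stabilizers of `d` and `e`. The torus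
acts on the range of `f` through the correct character, so equivariance for permutations suffices to
extend `f` to the induced representation. -/
theorem nonempty_equiv_boxtimes_orbitRep
    (hφ : ∀ u : Equiv.Perm (Fin n), (∀ i, d (u i) = d i) → ∃ h, φ h = u)
    (hψ : ∀ u : Equiv.Perm (Fin m), (∀ i, e (u i) = e i) → ∃ h, ψ h = u)
    (f : M ⊗[ℂ] N →ₗ[ℂ] B) (inj : Function.Injective f)
    (range : LinearMap.range f = weightSpace π d e)
    (hf : ∀ h h' u v, f (ρ h u ⊗ₜ σ h' v) =
      π (SemidirectProduct.inr (φ h), SemidirectProduct.inr (ψ h')) (f (u ⊗ₜ v))) :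
    Nonempty (Representation.Equiv (orbitPiece π d e).toRepresentation
      (boxtimes (orbitRep φ d hd ρ) (orbitRep ψ e he σ))) := by
  obtain ⟨F, hF, hF1⟩ := exists_boxtimes_ind_lift (torusExtHom φ) (torusExtHom ψ)
    (twist φ d hd ρ) (twist ψ e he σ) π f
    (map_twist_tmul φ ψ d e hd he π ρ σ f (fun x => range ▸ ⟨x, rfl⟩) hf)
  have hFL : F ∘ₗ indInclusion φ ψ d e hd he ρ σ = f := TensorProduct.ext' hF1
  refine nonempty_equiv_orbitPiece π _ d e F hF (indInclusion φ ψ d e hd he ρ σ) ?_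
    (iSup_range_indMk_one_tmul _ _ _ _) (hFL ▸ inj) (hFL ▸ range)
  rintro ⟨g, g'⟩ hg hg' z
  obtain ⟨h, hh⟩ := hφ _ hg
  obtain ⟨h', hh'⟩ := hψ _ hg'
  exact ⟨_, by
    rw [eq_torusExtHom φ g hh, eq_torusExtHom ψ g' hh']
    exact boxtimes_indInclusion φ ψ d e hd he ρ σ _ _ z⟩

end Single

/-- The summands cannot be treated separately, since only together do the maps `f j` fill the
component `(d, e)`; the reduction is applied to the sum of the generating subspaces. -/
theorem nonempty_equiv_directSum_boxtimes_orbitRep {ι : Type*} [DecidableEq ι] {M N : ι → Type*}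
    [∀ j, AddCommGroup (M j)] [∀ j, Module ℂ (M j)] [∀ j, AddCommGroup (N j)]
    [∀ j, Module ℂ (N j)] (ρ : ∀ j, Representation ℂ H (M j))
    (σ : ∀ j, Representation ℂ H' (N j))
    (hφ : ∀ u : Equiv.Perm (Fin n), (∀ i, d (u i) = d i) → ∃ h, φ h = u)
    (hψ : ∀ u : Equiv.Perm (Fin m), (∀ i, e (u i) = e i) → ∃ h, ψ h = u)
    (f : ∀ j, M j ⊗[ℂ] N j →ₗ[ℂ] B)
    (inj : Function.Injective (DirectSum.toModule ℂ ι B f))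
    (range : LinearMap.range (DirectSum.toModule ℂ ι B f) = weightSpace π d e)
    (hf : ∀ j h h' u v, f j (ρ j h u ⊗ₜ σ j h' v) =
      π (SemidirectProduct.inr (φ h), SemidirectProduct.inr (ψ h')) (f j (u ⊗ₜ v))) :
    Nonempty (Representation.Equiv (orbitPiece π d e).toRepresentation
      (Representation.directSum fun j =>
        boxtimes (orbitRep φ d hd (ρ j)) (orbitRep ψ e he (σ j)))) := by
  have hw (j x) : f j x ∈ weightSpace π d e := by
    rw [← range]
    exact ⟨_, DirectSum.toModule_lof ℂ (φ := f) j x⟩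
  choose F hF hF1 using fun j => exists_boxtimes_ind_lift (torusExtHom φ) (torusExtHom ψ)
    (twist φ d hd (ρ j)) (twist ψ e he (σ j)) π (f j)
    (map_twist_tmul φ ψ d e hd he π (ρ j) (σ j) (f j) (hw j) (hf j))
  let L := DirectSum.lmap fun j => indInclusion φ ψ d e hd he (ρ j) (σ j)
  have hL (j x) : L (DirectSum.lof ℂ ι _ j x) =
      DirectSum.lof ℂ ι _ j (indInclusion φ ψ d e hd he (ρ j) (σ j) x) :=
    DirectSum.lmap_lof _ _ _
  have hact (g j x) : Representation.directSum (fun j =>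
      boxtimes (orbitRep φ d hd (ρ j)) (orbitRep ψ e he (σ j))) g (DirectSum.lof ℂ ι _ j x) =
      DirectSum.lof ℂ ι _ j (boxtimes (orbitRep φ d hd (ρ j)) (orbitRep ψ e he (σ j)) g x) :=
    DirectSum.lmap_lof _ _ _
  have hFL : DirectSum.toModule ℂ ι B F ∘ₗ L = DirectSum.toModule ℂ ι B f := by
    refine DirectSum.linearMap_ext ℂ fun j => TensorProduct.ext' fun u v => ?_
    simp only [LinearMap.comp_apply, hL, DirectSum.toModule_lof]
    exact hF1 j u v
  refine nonempty_equiv_orbitPiece π _ d e (DirectSum.toModule ℂ ι B F) ?_ L ?_ ?_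
    (hFL ▸ inj) (hFL ▸ range)
  · intro g q
    suffices DirectSum.toModule ℂ ι B F ∘ₗ Representation.directSum (fun j =>
        boxtimes (orbitRep φ d hd (ρ j)) (orbitRep ψ e he (σ j))) g =
        π g ∘ₗ DirectSum.toModule ℂ ι B F from LinearMap.congr_fun this q
    refine DirectSum.linearMap_ext ℂ fun j => LinearMap.ext fun x => ?_
    simp only [LinearMap.comp_apply, hact, DirectSum.toModule_lof]
    exact hF j g x
  · rintro ⟨g, g'⟩ hg hg' z
    obtain ⟨h, hh⟩ := hφ _ hg
    obtain ⟨h', hh'⟩ := hψ _ hg'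
    refine ⟨DirectSum.lmap (fun j => boxtimes (twist φ d hd (ρ j)) (twist ψ e he (σ j))
      (⟨g.left, h⟩, ⟨g'.left, h'⟩)) z, ?_⟩
    rw [eq_torusExtHom φ g hh, eq_torusExtHom ψ g' hh']
    suffices Representation.directSum (fun j =>
        boxtimes (orbitRep φ d hd (ρ j)) (orbitRep ψ e he (σ j)))
        (torusExtHom φ ⟨g.left, h⟩, torusExtHom ψ ⟨g'.left, h'⟩) ∘ₗ L =
        L ∘ₗ DirectSum.lmap (fun j => boxtimes (twist φ d hd (ρ j)) (twist ψ e he (σ j))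
          (⟨g.left, h⟩, ⟨g'.left, h'⟩)) from LinearMap.congr_fun this z
    refine DirectSum.linearMap_ext ℂ fun j => LinearMap.ext fun x => ?_
    simp only [LinearMap.comp_apply, hL, hact, DirectSum.lmap_lof]
    exact congrArg _ (boxtimes_indInclusion φ ψ d e hd he (ρ j) (σ j) _ _ x)
  · rw [eq_top_iff]
    rintro q -
    induction q using DirectSum.induction_on with
    | zero => exact Submodule.zero_mem _
    | add x y hx hy => exact Submodule.add_mem _ hx hy
    | of j x =>
      change DirectSum.lof ℂ ι (fun j => IndSpace (torusExtHom φ) (twist φ d hd (ρ j)) ⊗[ℂ]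
        IndSpace (torusExtHom ψ) (twist ψ e he (σ j))) j x ∈ _
      have hx : x ∈ ⨆ k, (LinearMap.range (indInclusion φ ψ d e hd he (ρ j) (σ j))).map
          (boxtimes (orbitRep φ d hd (ρ j)) (orbitRep ψ e he (σ j)) k) := by
        have h1 : _ = ⊤ := iSup_range_indMk_one_tmul (torusExtHom φ) (torusExtHom ψ)
          (twist φ d hd (ρ j)) (twist ψ e he (σ j))
        exact h1 ▸ Submodule.mem_top
      refine Submodule.iSup_induction _ (motive := fun x => DirectSum.lof ℂ ι (fun j => IndSpace (torusExtHom φ) (twist φ d hd (ρ j)) ⊗[ℂ]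
        IndSpace (torusExtHom ψ) (twist ψ e he (σ j))) j x ∈ _) hx
        ?_ ?_ ?_
      · rintro k _ ⟨_, ⟨y, rfl⟩, rfl⟩
        refine Submodule.mem_iSup_of_mem k ⟨_, ⟨DirectSum.lof ℂ ι _ j y, rfl⟩, ?_⟩
        rw [hL, hact]
      · rw [map_zero]
        exact Submodule.zero_mem _
      · intro x y hx hy
        rw [map_add]
        exact Submodule.add_mem _ hx hy

end Recognition

/-! ### Assembly of the two cases -/

/-- The external product with trivial representations on both sides. -/
lemma exists_boxtimes_trivial_equiv {G₁ G₂ G₃ M₁ M₂ M₃ : Type*} [Group G₁] [Group G₂] [Group G₃]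
    [AddCommGroup M₁] [Module ℂ M₁] [AddCommGroup M₂] [Module ℂ M₂] [AddCommGroup M₃] [Module ℂ M₃]
    (ρ₁ : Representation ℂ G₁ M₁) (ρ₂ : Representation ℂ G₂ M₂) (ρ₃ : Representation ℂ G₃ M₃)
    (e₁ : M₁ ≃ₗ[ℂ] ℂ) (he₁ : ∀ g x, e₁ (ρ₁ g x) = e₁ x)
    (e₃ : M₃ ≃ₗ[ℂ] ℂ) (he₃ : ∀ g x, e₃ (ρ₃ g x) = e₃ x) :
    ∃ e : M₁ ⊗[ℂ] (M₂ ⊗[ℂ] M₃) ≃ₗ[ℂ] M₂,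
      ∀ g x, e (boxtimes ρ₁ (boxtimes ρ₂ ρ₃) g x) = ρ₂ g.2.1 (e x) := by
  let e : M₁ ⊗[ℂ] (M₂ ⊗[ℂ] M₃) ≃ₗ[ℂ] M₂ :=
    (TensorProduct.congr e₁ ((TensorProduct.congr (LinearEquiv.refl ℂ M₂) e₃).trans
      (TensorProduct.rid ℂ M₂))).trans (TensorProduct.lid ℂ M₂)
  have he (x y z) : e (x ⊗ₜ (y ⊗ₜ z)) = e₁ x • e₃ z • y := by
    simp [e, smul_comm (e₁ x)]
  refine ⟨e, fun g x => ?_⟩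
  suffices e.toLinearMap ∘ₗ boxtimes ρ₁ (boxtimes ρ₂ ρ₃) g = ρ₂ g.2.1 ∘ₗ e.toLinearMap from
    LinearMap.congr_fun this x
  refine TensorProduct.ext_threefold' fun x y z => ?_
  change e (ρ₁ g.1 x ⊗ₜ (ρ₂ g.2.1 y ⊗ₜ ρ₃ g.2.2 z)) = ρ₂ g.2.1 (e (x ⊗ₜ (y ⊗ₜ z)))
  rw [he, he, he₁, he₃, map_smul, map_smul]

/-- The external product with a one-dimensional representation. -/
lemma exists_tmul_equiv {M N : Type*} [AddCommGroup M] [Module ℂ M] [AddCommGroup N] [Module ℂ N]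
    (e : N ≃ₗ[ℂ] ℂ) : ∃ E : M ⊗[ℂ] N ≃ₗ[ℂ] M, ∀ u v, E (u ⊗ₜ v) = e v • u :=
  ⟨(TensorProduct.congr (LinearEquiv.refl ℂ M) e).trans (TensorProduct.rid ℂ M),
    fun u v => by simp⟩

theorem nonempty_equiv_of_ne {n a b r c : ℕ} (h : a + (b + r) = n) (hbc : (b - c) + c = b)
    (hc : 2 * c ≠ b) :
    Nonempty (Representation.Equiv
      (orbitPiece (extRep n) (blockDeg n a b 2 1 0)
        ![(a : ℤ) + b - c, (a : ℤ) + c]).toRepresentation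
      (boxtimes
        (orbit₃ h 2 1 0 (specht (row a))
          (indPair hbc (specht (col (b - c))) (specht (col c))) (specht (row r)))
        (orbit₁₁ ((a : ℤ) + b - c) ((a : ℤ) + c) (specht (row 1)) (specht (row 1))))) := by
  subst h
  obtain ⟨e₁, he₁⟩ := exists_specht_row a
  obtain ⟨e₃, he₃⟩ := exists_specht_row r
  obtain ⟨e₂, he₂⟩ := exists_indPair_col_equiv hbc
  obtain ⟨ε, -⟩ := exists_specht_row 1
  obtain ⟨e, he⟩ := exists_boxtimes_trivial_equiv (specht (row a))
    (indPair hbc (specht (col (b - c))) (specht (col c))) (specht (row r)) e₁ he₁ e₃ he₃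
  obtain ⟨E, hE⟩ := exists_tmul_equiv
    (M := SpechtModule (row a) ⊗[ℂ] (IndSpace (young₂ hbc)
      (boxtimes (specht (col (b - c))) (specht (col c))) ⊗[ℂ] SpechtModule (row r)))
    ((TensorProduct.congr ε ε).trans (TensorProduct.lid ℂ ℂ))
  let E' := (E.trans e).trans e₂
  have hE' (x) : E' x = e₂ (e (E x)) := rfl
  have hrange : LinearMap.range E'.toLinearMap = ⊤ := LinearEquiv.range E'
  refine nonempty_equiv_boxtimes_orbitRep (young₃ rfl) (young₂ rfl) _ _
    (blockDeg_young₃ rfl 2 1 0) (pair_young₂ _ _) _ _ _ (exists_young₃_eq rfl) (fun u hu => ?_)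
    (blockMap a b r c ∘ₗ E'.toLinearMap) ((blockMap_injective a b r c).comp E'.injective)
    (by rw [LinearMap.range_comp, hrange, Submodule.map_top, range_blockMap]) ?_
  · refine ⟨1, ?_⟩
    -- The transposition would force `a + b - c = a + c`, that is `b = 2c`; so the stabilizer in
    -- `𝔖_2` is trivial.
    rcases perm_two u with rfl | rfl
    · rw [map_one]
    · have h0 := hu 0
      simp only [Equiv.swap_apply_left, Matrix.cons_val_zero, Matrix.cons_val_one] at h0
      omega
  · intro x y u v
    obtain rfl : y = 1 := Subsingleton.elim _ _
    rw [map_one, map_one, Module.End.one_apply]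
    change blockMap a b r c (E' (_ ⊗ₜ v)) = extRep _ _ (blockMap a b r c (E' (u ⊗ₜ v)))
    rw [hE', hE', hE, hE, map_smul, map_smul, he, he₂, ← map_smul, ← map_smul,
      blockMap_sliceRep, map_smul e]

theorem nonempty_equiv_of_eq {n a r c : ℕ} (h : a + (2 * c + r) = n)
    (hj : ∀ j : Fin (c + 1), 2 * (c - (j : ℕ)) + 2 * j = 2 * c) :
    Nonempty (Representation.Equiv
      (orbitPiece (extRep n) (blockDeg n a (2 * c) 2 1 0) (fun _ => (a : ℤ) + c)).toRepresentation
      (Representation.directSum fun j : Fin (c + 1) =>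
        boxtimes
          (orbit₃ h 2 1 0 (specht (row a))
            (specht (twoOne (m := 2 * c) (c - (j : ℕ)) (2 * j) (hj j))) (specht (row r)))
          (orbit₁ 2 ((a : ℤ) + c) (tensorPower (specht (col 2)) (a + c - (j : ℕ)))))) := by
  subst h
  obtain ⟨e₁, he₁⟩ := exists_specht_row a
  obtain ⟨e₃, he₃⟩ := exists_specht_row r
  choose ε hε using fun j : Fin (c + 1) => exists_tensorPower_specht_col (a + c - (j : ℕ))
  choose e he using fun j : Fin (c + 1) => exists_boxtimes_trivial_equiv (specht (row a))
    (specht (twoOne (m := 2 * c) (c - (j : ℕ)) (2 * j) (hj j))) (specht (row r)) e₁ he₁ e₃ he₃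
  choose E hE using fun j : Fin (c + 1) => exists_tmul_equiv
    (M := SpechtModule (row a) ⊗[ℂ] (SpechtModule (twoOne (m := 2 * c) (c - (j : ℕ)) (2 * j) (hj j))
      ⊗[ℂ] SpechtModule (row r))) (ε j)
  let E' j := (E j).trans (e j)
  have hE' (j x) : E' j x = e j (E j x) := rfl
  let f j := blockMap a (2 * c) r c ∘ₗ spechtMap (hj j) c ∘ₗ (E' j).toLinearMap
  have hf (j x) : f j x = blockMap a (2 * c) r c (spechtMap (hj j) c (E' j x)) := rfl
  let Φ := DirectSum.lmap fun j => (E' j).toLinearMap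
  have htot : DirectSum.toModule ℂ (Fin (c + 1)) _ f =
      blockMap a (2 * c) r c ∘ₗ spechtSumMap c hj ∘ₗ Φ := by
    refine DirectSum.linearMap_ext ℂ fun j => LinearMap.ext fun x => ?_
    simp only [LinearMap.comp_apply, DirectSum.toModule_lof, Φ, DirectSum.lmap_lof, spechtSumMap]
    rfl
  have hΦi : Function.Injective Φ := (DirectSum.lmap_injective _).2 fun j => (E' j).injective
  have hΦs : Function.Surjective Φ := (DirectSum.lmap_surjective _).2 fun j => (E' j).surjective
  have hdeg : (fun _ => (a : ℤ) + c) = ![(a : ℤ) + (2 * c : ℕ) - c, (a : ℤ) + c] := by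
    funext j
    fin_cases j <;> simp
    ring
  refine nonempty_equiv_directSum_boxtimes_orbitRep (young₃ rfl) (MonoidHom.id _) _ _
    (blockDeg_young₃ rfl 2 1 0) (fun _ _ => rfl) _ _ _ (exists_young₃_eq rfl)
    (fun u _ => ⟨u, rfl⟩) f ?_ ?_ ?_
  · rw [htot]
    exact (blockMap_injective a (2 * c) r c).comp ((spechtSumMap_injective c hj).comp hΦi)
  · have hs : LinearMap.range (spechtSumMap c hj ∘ₗ Φ) = ⊤ :=
      LinearMap.range_eq_top.2 ((spechtSumMap_surjective c hj).comp hΦs)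
    rw [htot, LinearMap.range_comp, hs, Submodule.map_top, range_blockMap, hdeg]
  · intro j x τ u v
    -- The transposition gives `(-1)^a` from the first block and `(-1)^{c-j}` from complementation,
    -- in total the sign to the power `a + c - j`.
    have hτ (y) : extRep (a + (2 * c + r)) (1, SemidirectProduct.inr τ)
        (blockMap a (2 * c) r c (spechtMap (hj j) c y)) =
        csign τ ^ (a + c - (j : ℕ)) • blockMap a (2 * c) r c (spechtMap (hj j) c y) := by
      rcases perm_two τ with rfl | rfl
      · rw [map_one, ← Prod.one_eq_mk, map_one]
        simp [csign]
      · have h1 := blockMap_complMap (a := a) (r := r) (spechtMap (hj j) c y)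
        rw [map_one, complMap_spechtMap, map_smul, smul_smul, ← pow_add] at h1
        rw [h1, show a + c - (j : ℕ) = a + (c - (j : ℕ)) by omega]
        simp [csign]
    -- The two symmetric groups are handled separately: `𝔖_2` by the scalar just found, and the
    -- Young subgroup by the equivariance of `blockMap` and `spechtMap`.
    have hsplit : ((SemidirectProduct.inr (young₃ rfl x), SemidirectProduct.inr τ) :
        G (a + (2 * c + r)) × G 2) =
        (SemidirectProduct.inr (young₃ rfl x), SemidirectProduct.inr 1) *
          (1, SemidirectProduct.inr τ) := by
      rw [Prod.mk_mul_mk, mul_one, map_one, one_mul]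
    change f j (_ ⊗ₜ _) = extRep _ (SemidirectProduct.inr (young₃ rfl x), SemidirectProduct.inr τ)
      (f j (u ⊗ₜ v))
    rw [hf, hf, hE', hE', hE, hE, hε, map_smul, map_smul, he, spechtMap_specht, mul_smul,
      hsplit, map_mul, Module.End.mul_apply, hτ, map_smul, map_smul, map_smul, blockMap_sliceRep]
    simp only [map_smul]

end TorusSym

end

theorem proposition2 (n a b c : ℕ) (hab : a + b ≤ n) (hc : c ≤ b / 2) :
    (2 * c ≠ b →
      Nonempty (Representation.Equiv
        (orbitPiece (extRep n) (blockDeg n a b 2 1 0)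
          ![(a : ℤ) + b - c, (a : ℤ) + c]).toRepresentation
        (boxtimes
          (orbit₃ (p := a) (q := b) (r := n - a - b) (n := n) (by omega) 2 1 0
            (specht (row a))
            (indPair (p := b - c) (q := c) (m := b) (by omega)
              (specht (col (b - c))) (specht (col c)))
            (specht (row (n - a - b))))
          (orbit₁₁ ((a : ℤ) + b - c) ((a : ℤ) + c) (specht (row 1)) (specht (row 1)))))) ∧
    (∀ h : 2 * c = b,
      Nonempty (Representation.Equiv
        (orbitPiece (extRep n) (blockDeg n a b 2 1 0)
          ![(a : ℤ) + b - c, (a : ℤ) + c]).toRepresentation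
        (Representation.directSum fun j : Fin (c + 1) =>
          boxtimes
            (orbit₃ (p := a) (q := b) (r := n - a - b) (n := n) (by omega) 2 1 0
              (specht (row a))
              (specht (twoOne (m := b) (c - j) (2 * j) (by omega)))
              (specht (row (n - a - b))))
            (orbit₁ 2 ((a : ℤ) + c) (tensorPower (specht (col 2)) (a + c - j)))))) := by
  refine ⟨fun h => nonempty_equiv_of_ne (by omega) (by omega) h, ?_⟩
  rintro rfl
  have hdeg : ![(a : ℤ) + (2 * c : ℕ) - c, (a : ℤ) + c] = fun _ => (a : ℤ) + c := by
    funext j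
    fin_cases j <;> simp
    ring
  rw [hdeg]
  exact nonempty_equiv_of_eq (by omega) fun j => by omega
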